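/- Consider the problem $\min f_0(x)$ subject to $f_j(x)\le 0$, $j\in I=\{1,\dots,m\}$, $x\in\mathbb R^n$, where $f_0,f_1,\dots,f_m:\mathbb R^n\to\mathbb R$ are twice continuously differentiable; write $g_j=\nabla f_j$, $\|\cdot\|$ for the Euclidean norm, $\varphi(x)=\max\{0,f_j(x):j\in I\}$, $\bar f_j(x)=f_j(x)$ if $f_j(x)\le 0$ and $\bar f_j(x)=f_j(x)-\varphi(x)$ if $f_j(x)>0$, $I(x)=\{j\in I:\bar f_j(x)=0\}$, and $L(x,\lambda)=f_0(x)+\sum_{j\in I}\lambda_jf_j(x)$. A KKT pair is a pair $(x,\lambda)$ with $\nabla_xL(x,\lambda)=0$ and $f_j(x)\le0$, $\lambda_j\ge0$, $\lambda_jf_j(x)=0$ for all $j\in I$. **Algorithm.** Parameters: $\gamma,\eta,\varepsilon\in(0,1)$, $0<\theta<\sigma<1$, $0<\varrho<\sigma$, $\xi,\zeta>0$, $\alpha\in(0,\frac12)$, $\rho>1$, $\delta>2$, $\tau\in(2,3)$. The starting point $x^0\in\mathbb R^n$ and the symmetric positive definite matrix $B_0$ are arbitrary. At iteration $k$, let $\varphi_k=\varphi(x^k)$.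 1. Let $d_0^k$ be the solution of $\min_d\ g_0(x^k)^Td+\frac12d^TB_kd$ subject to $\bar f_j(x^k)+g_j(x^k)^Td\le0$, $j\in I$, and $\lambda^k$ a corresponding KKT multiplier vector. If $d_0^k=0$ and $\varphi_k=0$, stop. 2. Let $N_k$ be the matrix with columns $g_j(x^k)$, let $D^k=\mathrm{diag}(D^k_j)$ with $D_j^k=|\bar f_j(x^k)|\,(|\bar f_j(x^k)+g_j(x^k)^Td_0^k|+\|d_0^k\|)$, and let $V_k=\begin{pmatrix}B_k&N_k\\N_k^T&-D^k\end{pmatrix}$. Let $(d_1^k,h_1^k)$ solve $V_k\binom{d}{h}=\binom{0}{r}$ with $r_j=-(\|d_0^k\|^\tau+\varphi_k^\sigma)-(f_j(x^k+d_0^k)-f_j(x^k)-g_j(x^k)^Td_0^k)$, and put $d^k=d_0^k+d_1^k$. If $g_0(x^k)^Td_0^k\le\zeta\min\{-\|d_0^k\|^\delta,-\|d^k\|^\delta\}+\xi\varphi_k^\varrho$, go to 3, otherwise to 4. 3. Let $t_k$ be the first $t$ among $1,\frac12,\frac14,\dots$ with $t\ge\varepsilon$ such that $f_0(x^k+td^k)\le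 f_0(x^k)+\alpha t\,g_0(x^k)^Td_0^k+\rho(1-\alpha)t\varphi_k^\theta$, such that $f_j(x^k+td^k)\le\varphi_k-\alpha t(\|d_0^k\|^\tau+\varphi_k^\sigma)$ for all $j$ with $f_j(x^k)>0$, and such that $f_j(x^k+td^k)\le0$ for all $j$ with $f_j(x^k)\le0$; then go to 6. If there is no such $t$, go to 4. 4. Let $(\tilde d^k,\tilde h^k)$ solve $V_k\binom dh=\binom{0}{r}$ with $r_j=-(\|d_0^k\|+\varphi_k^\sigma)$ for all $j$. Put $\beta_k=\min\Big\{1,\frac{(\theta-1)g_0(x^k)^Td_0^k+\varphi_k^\theta}{g_0(x^k)^T\tilde d^k-g_0(x^k)^Td_0^k}\Big\}$ if $g_0(x^k)^T\tilde d^k>g_0(x^k)^Td_0^k$ and $\beta_k=1$ otherwise, and $q^k=(1-\beta_k)d_0^k+\beta_k\tilde d^k$. 5. Let $t_k$ be the first $t$ among $1,\eta,\eta^2,\dots$ such that $f_0(x^k+tq^k)\le f_0(x^k)+\gamma t\,g_0(x^k)^Tq^k+\rho(1-\gamma)t\varphi_k^\theta$, such that $f_j(x^k+tq^k)\le\varphi_k-\gamma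 t\beta_k(\|d_0^k\|+\varphi_k^\sigma)$ for all $j$ with $f_j(x^k)>0$, and such that $f_j(x^k+tq^k)\le0$ for all $j$ with $f_j(x^k)\le0$. Redefine $d^k=q^k$. 6. Put $x^{k+1}=x^k+t_kd^k$, choose any symmetric positive definite matrix $B_{k+1}$, and go to 1 with $k+1$ in place of $k$. **Theorem.** Suppose that for every $x\in\mathbb R^n$ the vectors $g_j(x)$, $j\in I(x)$, are linearly independent. Let $\{x^k\}$ be an infinite sequence generated by the algorithm, and suppose that there are constants $a,b>0$ with $a\|d\|^2\le d^TB_kd\le b\|d\|^2$ for all $d\in\mathbb R^n$ and all $k$. Suppose that $\{x^k\}$ is bounded and has an accumulation point $x^*$ such that every KKT pair of the form $(x^*,\lambda^*)$ satisfies (a) $d^T\nabla^2_{xx}L(x^*,\lambda^*)d>0$ for all $d\ne0$ with $g_j(x^*)^Td=0$ for all $j$ with $\lambda_j^*>0$ (strong second-order sufficient condition), and (b) $\|(\nabla^2_{xx}L(x^*,\lambda^*)-B_k)d_0^k\|=o(\|d_0^k\|)$ as $k\to\infty$. Then $x^*$ is a KKT point (there is $\lambda^*$ such that $(x^*,\lambda^*)$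 is a KKT pair), $x^k\to x^*$, and $\|x^{k+1}-x^*\|=o(\|x^k-x^*\|)$ as $k\to\infty$, i.e. the convergence is superlinear. Strict complementarity is not assumed. -/

import Mathlib

open Filter Topology Asymptotics
open scoped InnerProductSpace Gradient

noncomputable section

namespace NCP

/-- The space `ℝⁿ` with its Euclidean norm. -/
abbrev E (n : ℕ) : Type := EuclideanSpace ℝ (Fin n)

/-- The data of the problem `min f₀(x)` subject to `f_j(x) ≤ 0`, `j = 1, …, m`, on `ℝⁿ`. -/
structure Problem (n m : ℕ) where
  f₀ : E n → ℝ
  f : Fin m → E n → ℝ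

/-- The parameters of the algorithm. -/
structure Params where
  γ : ℝ
  η : ℝ
  ε : ℝ
  θ : ℝ
  σ : ℝ
  ϱ : ℝ
  ξ : ℝ
  ζ : ℝ
  α : ℝ
  ρ : ℝ
  δ : ℝ
  τ : ℝ

/-- The admissible ranges of the parameters. -/
structure Params.Admissible (p : Params) : Prop where
  γ_mem : p.γ ∈ Set.Ioo (0 : ℝ) 1
  η_mem : p.η ∈ Set.Ioo (0 : ℝ) 1
  ε_mem : p.ε ∈ Set.Ioo (0 : ℝ) 1
  θ_pos : 0 < p.θ
  θ_lt : p.θ < p.σ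
  σ_lt : p.σ < 1
  ϱ_pos : 0 < p.ϱ
  ϱ_lt : p.ϱ < p.σ
  ξ_pos : 0 < p.ξ
  ζ_pos : 0 < p.ζ
  α_mem : p.α ∈ Set.Ioo (0 : ℝ) (1 / 2)
  ρ_gt : 1 < p.ρ
  δ_gt : 2 < p.δ
  τ_mem : p.τ ∈ Set.Ioo (2 : ℝ) 3

variable {n m : ℕ}

/-- The action `d ↦ B d` of a matrix on `ℝⁿ`. -/
def act (B : Matrix (Fin n) (Fin n) ℝ) (d : E n) : E n :=
  Matrix.toEuclideanLin B d

/-- The Hessian `∇²h(x)`, as the derivative of the gradient field of `h`. -/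
def hess (h : E n → ℝ) (x : E n) : E n →L[ℝ] E n :=
  fderiv ℝ (fun y => ∇ h y) x

namespace Problem

variable (P : Problem n m)

/-- The gradient `g₀(x) = ∇f₀(x)`. -/
def g₀ (x : E n) : E n := ∇ P.f₀ x

/-- The gradient `g_j(x) = ∇f_j(x)`. -/
def g (j : Fin m) (x : E n) : E n := ∇ (P.f j) x

/-- `φ(x) = max {0, f_j(x), j = 1, …, m}`. -/
def phi (x : E n) : ℝ := Finset.univ.fold max 0 (fun j => P.f j x)

/-- `f̄_j(x)`: equal to `f_j(x)` if `f_j(x) ≤ 0`, and to `f_j(x) - φ(x)` if `f_j(x) > 0`. -/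
def fbar (j : Fin m) (x : E n) : ℝ :=
  if P.f j x ≤ 0 then P.f j x else P.f j x - P.phi x

/-- The index set `I(x) = {j : f̄_j(x) = 0}`. -/
def activeSet (x : E n) : Set (Fin m) := {j | P.fbar j x = 0}

/-- The Lagrangian `L(x, lam) = f₀(x) + ∑ⱼ lam_j f_j(x)`. -/
def lagrangian (lam : Fin m → ℝ) (x : E n) : ℝ :=
  P.f₀ x + ∑ j, lam j * P.f j x

/-- `(x, lam)` is a KKT pair of the problem. -/
structure IsKKTPair (x : E n) (lam : Fin m → ℝ) : Prop where
  stationary : P.g₀ x + ∑ j, lam j • P.g j x = 0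
  feasible : ∀ j, P.f j x ≤ 0
  nonneg : ∀ j, 0 ≤ lam j
  complementary : ∀ j, lam j * P.f j x = 0

/-- The gradients `g_j(x)`, `j ∈ I(x)`, are linearly independent, at every `x ∈ ℝⁿ`. -/
def GradientsIndependent : Prop :=
  ∀ x : E n, LinearIndependent ℝ (fun j : P.activeSet x => P.g j x)

/-- The strong second-order sufficient condition at `(x, lam)`: the Hessian of the Lagrangian is
positive on every nonzero `d` orthogonal to all `g_j(x)` with `lam_j > 0`. -/
def SSOSC (x : E n) (lam : Fin m → ℝ) : Prop :=
  ∀ d : E n, d ≠ 0 → (∀ j, 0 < lam j → ⟪P.g j x, d⟫_ℝ = 0) →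
    0 < ⟪d, hess (P.lagrangian lam) x d⟫_ℝ

/-- Feasibility of `d` for the quadratic subproblem at `x`. -/
def QPFeasible (x d : E n) : Prop :=
  ∀ j, P.fbar j x + ⟪P.g j x, d⟫_ℝ ≤ 0

/-- The objective function `g₀(x)ᵀd + ½ dᵀBd` of the quadratic subproblem. -/
def qpObj (x : E n) (B : Matrix (Fin n) (Fin n) ℝ) (d : E n) : ℝ :=
  ⟪P.g₀ x, d⟫_ℝ + 1 / 2 * ⟪d, act B d⟫_ℝ

/-- `d` is an optimal solution of the quadratic subproblem at `x` with matrix `B`. -/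
def IsQPSolution (x : E n) (B : Matrix (Fin n) (Fin n) ℝ) (d : E n) : Prop :=
  P.QPFeasible x d ∧ ∀ d', P.QPFeasible x d' → P.qpObj x B d ≤ P.qpObj x B d'

/-- `lam` is a KKT multiplier vector of the quadratic subproblem at its solution `d`. -/
structure IsQPMultiplier (x : E n) (B : Matrix (Fin n) (Fin n) ℝ) (d : E n)
    (lam : Fin m → ℝ) : Prop where
  stationary : P.g₀ x + act B d + ∑ j, lam j • P.g j x = 0
  nonneg : ∀ j, 0 ≤ lam j
  complementary : ∀ j, lam j * (P.fbar j x + ⟪P.g j x, d⟫_ℝ) = 0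

/-- The diagonal entry `D_j = |f̄_j(x)| (|f̄_j(x) + g_j(x)ᵀd₀| + ‖d₀‖)`. -/
def diag (x d₀ : E n) (j : Fin m) : ℝ :=
  |P.fbar j x| * (|P.fbar j x + ⟪P.g j x, d₀⟫_ℝ| + ‖d₀‖)

/-- `(d, h)` solves the linear system with the block matrix `[[B, N], [Nᵀ, -D]]`, where `N` has the
columns `g_j(x)` and `D` is the diagonal matrix above, and with right-hand side `(0, r)`. -/
def SolvesSLE (x : E n) (B : Matrix (Fin n) (Fin n) ℝ) (d₀ : E n) (r : Fin m → ℝ)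
    (d : E n) (h : Fin m → ℝ) : Prop :=
  act B d + ∑ j, h j • P.g j x = 0 ∧
    ∀ j, ⟪P.g j x, d⟫_ℝ - P.diag x d₀ j * h j = r j

/-- Right-hand side of the system for the feasible direction: `-(‖d₀‖ + φ^σ)`. -/
def rhsTilde (p : Params) (x d₀ : E n) : Fin m → ℝ :=
  fun _ => -(‖d₀‖ + P.phi x ^ p.σ)

/-- Right-hand side of the system for the correction direction:
`-(‖d₀‖^τ + φ^σ) - (f_j(x + d₀) - f_j(x) - g_j(x)ᵀd₀)`. -/
def rhsCorr (p : Params) (x d₀ : E n) : Fin m → ℝ :=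
  fun j => -(‖d₀‖ ^ p.τ + P.phi x ^ p.σ) - (P.f j (x + d₀) - P.f j x - ⟪P.g j x, d₀⟫_ℝ)

/-- The weight `β` of the convex combination of `d₀` and `dt`. -/
def beta (p : Params) (x d₀ dt : E n) : ℝ :=
  if ⟪P.g₀ x, d₀⟫_ℝ < ⟪P.g₀ x, dt⟫_ℝ then
    min 1 (((p.θ - 1) * ⟪P.g₀ x, d₀⟫_ℝ + P.phi x ^ p.θ) /
      (⟪P.g₀ x, dt⟫_ℝ - ⟪P.g₀ x, d₀⟫_ℝ))
  else 1

/-- The direction `q = (1 - β) d₀ + β dt`. -/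
def q (p : Params) (x d₀ dt : E n) : E n :=
  (1 - P.beta p x d₀ dt) • d₀ + P.beta p x d₀ dt • dt

/-- The test that `d = d₀ + d₁` has to pass before the first line search is tried. -/
def DirectionTest (p : Params) (x d₀ d : E n) : Prop :=
  ⟪P.g₀ x, d₀⟫_ℝ ≤ p.ζ * min (-‖d₀‖ ^ p.δ) (-‖d‖ ^ p.δ) + p.ξ * P.phi x ^ p.ϱ

/-- The acceptance test of the first line search, along `d = d₀ + d₁`, for the step length `t`. -/
structure AcceptI (p : Params) (x d₀ d : E n) (t : ℝ) : Prop where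
  objective : P.f₀ (x + t • d) ≤
    P.f₀ x + p.α * t * ⟪P.g₀ x, d₀⟫_ℝ + p.ρ * (1 - p.α) * t * P.phi x ^ p.θ
  violated : ∀ j, 0 < P.f j x →
    P.f j (x + t • d) ≤ P.phi x - p.α * t * (‖d₀‖ ^ p.τ + P.phi x ^ p.σ)
  satisfied : ∀ j, P.f j x ≤ 0 → P.f j (x + t • d) ≤ 0

/-- The acceptance test of the second line search, along `q`, for the step length `t`. -/
structure AcceptII (p : Params) (x d₀ dt : E n) (t : ℝ) : Prop where
  objective : P.f₀ (x + t • P.q p x d₀ dt) ≤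
    P.f₀ x + p.γ * t * ⟪P.g₀ x, P.q p x d₀ dt⟫_ℝ + p.ρ * (1 - p.γ) * t * P.phi x ^ p.θ
  violated : ∀ j, 0 < P.f j x →
    P.f j (x + t • P.q p x d₀ dt) ≤
      P.phi x - p.γ * t * P.beta p x d₀ dt * (‖d₀‖ + P.phi x ^ p.σ)
  satisfied : ∀ j, P.f j x ≤ 0 → P.f j (x + t • P.q p x d₀ dt) ≤ 0

/-- The first line search, over `t = 1, 1/2, 1/4, …` as long as `t ≥ ε`, accepts a step length. -/
def SearchISucceeds (p : Params) (x d₀ d : E n) : Prop :=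
  ∃ i : ℕ, p.ε ≤ (1 / 2 : ℝ) ^ i ∧ P.AcceptI p x d₀ d ((1 / 2) ^ i)

/-- Update of cycle I: the direction test holds, and `x'` is obtained from `x` along `d = d₀ + d₁`
with the first accepted step length among `1, 1/2, 1/4, …`, which is at least `ε`. -/
def CycleI (p : Params) (x d₀ d₁ x' : E n) : Prop :=
  P.DirectionTest p x d₀ (d₀ + d₁) ∧
    ∃ i : ℕ, p.ε ≤ (1 / 2 : ℝ) ^ i ∧ P.AcceptI p x d₀ (d₀ + d₁) ((1 / 2) ^ i) ∧
      (∀ l < i, ¬ P.AcceptI p x d₀ (d₀ + d₁) ((1 / 2) ^ l)) ∧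
      x' = x + ((1 / 2 : ℝ) ^ i) • (d₀ + d₁)

/-- Update of cycle II: the direction test or the first line search fails, and `x'` is obtained from
`x` along `q` with the first accepted step length among `1, η, η², …`. -/
def CycleII (p : Params) (x : E n) (B : Matrix (Fin n) (Fin n) ℝ) (d₀ d₁ x' : E n) : Prop :=
  ¬ (P.DirectionTest p x d₀ (d₀ + d₁) ∧ P.SearchISucceeds p x d₀ (d₀ + d₁)) ∧
    ∃ (dt : E n) (ht : Fin m → ℝ), P.SolvesSLE x B d₀ (P.rhsTilde p x d₀) dt ht ∧
      ∃ i : ℕ, P.AcceptII p x d₀ dt (p.η ^ i) ∧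
        (∀ l < i, ¬ P.AcceptII p x d₀ dt (p.η ^ l)) ∧
        x' = x + (p.η ^ i) • P.q p x d₀ dt

/-- An infinite run of the algorithm: the iterates `x k`, the symmetric positive definite matrices
`B k` (updated in an arbitrary way), the solutions `d₀ k` of the quadratic subproblems with their
multipliers `lam k`, and the correction directions `d₁ k`. The starting data `x 0` and `B 0` are
arbitrary. That the run is infinite means that the stopping test `(d₀ k, φ(x k)) = (0, 0)` is never
satisfied. -/
structure IsRun (p : Params) (x : ℕ → E n) (B : ℕ → Matrix (Fin n) (Fin n) ℝ)
    (d₀ : ℕ → E n) (lam : ℕ → Fin m → ℝ) (d₁ : ℕ → E n) : Prop where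
  posDef : ∀ k, (B k).PosDef
  qp : ∀ k, P.IsQPSolution (x k) (B k) (d₀ k)
  multiplier : ∀ k, P.IsQPMultiplier (x k) (B k) (d₀ k) (lam k)
  not_stopped : ∀ k, ¬ (d₀ k = 0 ∧ P.phi (x k) = 0)
  correction : ∀ k, ∃ h₁ : Fin m → ℝ,
    P.SolvesSLE (x k) (B k) (d₀ k) (P.rhsCorr p (x k) (d₀ k)) (d₁ k) h₁
  update : ∀ k, P.CycleI p (x k) (d₀ k) (d₁ k) (x (k + 1)) ∨
    P.CycleII p (x k) (B k) (d₀ k) (d₁ k) (x (k + 1))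

end Problem

/-- The matrices `B k` are uniformly positive definite (and uniformly bounded). -/
def UniformlyPosDef (B : ℕ → Matrix (Fin n) (Fin n) ℝ) : Prop :=
  ∃ a b : ℝ, 0 < a ∧ 0 < b ∧ ∀ (k : ℕ) (d : E n),
    a * ‖d‖ ^ 2 ≤ ⟪d, act (B k) d⟫_ℝ ∧ ⟪d, act (B k) d⟫_ℝ ≤ b * ‖d‖ ^ 2

end NCP

end

/-! Everything rests on one compactness estimate, `exists_norm_le_of_gradientsIndependent`: over a
compact set, a coefficient vector is controlled by its combination of the gradients together with
its components weighted by `|fbar j|`. With the energy identities of the quadratic subproblem and of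
the block system, it bounds all directions and multipliers uniformly (`exists_iterBounds`).

Global phase. The step lengths of the second line search are bounded below, so in either cycle a
violation that stays positive drops by at least `c * φ ^ σ`. As `σ < 1`, this cannot go on forever:
some iterate is feasible, and feasibility persists. From then on `f₀` falls by at least `c * ‖d₀‖ ^
2` per step while bounded below on the iterates, hence `d₀ → 0` (`eventually_feasible_and_tendsto`).

Local phase. Along the filter of indices whose iterates approach `xstar`, the subproblem conditions
pass to the limit, which gives a KKT pair with multiplier `mu`, and `lam k` tends to `mu`. Write `u
= x k - xstar`, `w = u + d₀ k`, and `H` for the Hessian of the Lagrangian. Subtracting the two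
stationarity conditions yields `H w + ∑ (lam j - mu j) • g j = o(‖u‖ + ‖d₀‖)`. When this is paired
with `w`, complementarity makes the multiplier sum nonnegative up to a small error; this replaces
strict complementarity. The second-order condition then gives `w = o(‖u‖ + ‖d₀‖)`
(`RunNear.full_step_isLittleO`). So `‖u‖` and `‖d₀‖` are comparable near `xstar`; since the steps
are `O(‖d₀‖)` and `d₀ → 0`, iterates cannot leave a small ball, and the whole sequence converges
(`RunNear.tendsto_atTop`).

Finally, `d₁` is `O(‖d₀‖²)` and compensates the curvature of the constraints, so the unit step along
`d₀ + d₁` is eventually accepted (`RunNear.eventually_unit_step`), and `x (k + 1) - xstar = w + d₁`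
is `o(‖u‖)`. -/

namespace NCP

variable {n m : ℕ}

/-! ### Taylor estimates and penalized quadratic forms. -/

theorem contDiff_gradient {h : E n → ℝ} (hh : ContDiff ℝ 2 h) :
    ContDiff ℝ 1 (fun x => ∇ h x) :=
  ((InnerProductSpace.toDual ℝ (E n)).symm.toContinuousLinearEquiv.contDiff).comp
    (hh.fderiv_right (m := 1) (by norm_num))

theorem hasFDerivAt_of_contDiff {h : E n → ℝ} (hh : ContDiff ℝ 2 h) (x : E n) :
    HasFDerivAt h (innerSL ℝ (∇ h x)) x := by
  have h1 := (hh.differentiable (by norm_num) x).hasGradientAt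
  exact h1.hasFDerivAt

/-- On a ball, a `C²` function and its gradient are Lipschitz, and the error of the first order
Taylor expansion is bounded by a multiple of the square of the step. -/
theorem exists_taylor_bound {h : E n → ℝ} (hh : ContDiff ℝ 2 h) (R : ℝ) :
    ∃ M : ℝ, ∀ x ∈ Metric.closedBall (0 : E n) R, ∀ y ∈ Metric.closedBall (0 : E n) R,
      |h y - h x| ≤ M * ‖y - x‖ ∧ ‖∇ h y - ∇ h x‖ ≤ M * ‖y - x‖ ∧
      |h y - h x - ⟪∇ h x, y - x⟫_ℝ| ≤ M * ‖y - x‖ ^ 2 := by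
  have hg := contDiff_gradient hh
  obtain ⟨M₁, hM₁⟩ := (isCompact_closedBall (0 : E n) R).exists_bound_of_continuousOn
    hg.continuous.continuousOn
  obtain ⟨M₂, hM₂⟩ := (isCompact_closedBall (0 : E n) R).exists_bound_of_continuousOn
    (hg.continuous_fderiv (by norm_num)).continuousOn
  have hc := convex_closedBall (0 : E n) R
  refine ⟨max M₁ M₂, fun x hx y hy => ?_⟩
  have hlip : ∀ z ∈ Metric.closedBall (0 : E n) R, ‖∇ h z - ∇ h x‖ ≤ M₂ * ‖z - x‖ :=
    fun z hz => hc.norm_image_sub_le_of_norm_fderiv_le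
      (fun z _ => (hg.differentiable (by norm_num)) z) hM₂ hx hz
  have hM₂0 : 0 ≤ M₂ := (norm_nonneg _).trans (hM₂ x hx)
  refine ⟨?_, ?_, ?_⟩
  · refine (hc.norm_image_sub_le_of_norm_hasFDerivWithin_le
      (fun z _ => (hasFDerivAt_of_contDiff hh z).hasFDerivWithinAt) (C := M₁)
      (fun z hz => ?_) hx hy).trans ?_
    · simpa using hM₁ z hz
    · gcongr; exact le_max_left _ _
  · refine (hlip y hy).trans ?_
    gcongr; exact le_max_right _ _
  · have hseg := hc.segment_subset hx hy
    have key := (convex_segment x y).norm_image_sub_le_of_norm_hasFDerivWithin_le'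
      (fun z _ => (hasFDerivAt_of_contDiff hh z).hasFDerivWithinAt) (φ := innerSL ℝ (∇ h x))
      (C := M₂ * ‖y - x‖) (fun z hz => ?_) (left_mem_segment ℝ x y) (right_mem_segment ℝ x y)
    · simp only [innerSL_apply_apply, Real.norm_eq_abs] at key
      refine key.trans ?_
      rw [mul_assoc, ← sq]
      gcongr; exact le_max_right _ _
    · rw [← map_sub, innerSL_apply_norm]
      refine (hlip z (hseg hz)).trans ?_
      gcongr
      obtain ⟨s, hs, rfl⟩ := (segment_eq_image' ℝ x y) ▸ hz
      rw [add_sub_cancel_left, norm_smul, Real.norm_eq_abs, abs_of_nonneg hs.1]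
      exact mul_le_of_le_one_left (norm_nonneg _) hs.2

/-- First order expansion of the gradient of a `C²` function, along a filter. -/
theorem gradient_sub_isLittleO {ι : Type*} {l : Filter ι} {h : E n → ℝ} (hh : ContDiff ℝ 2 h)
    {z : E n} {x y : ι → E n} (hx : Tendsto x l (𝓝 z)) (hy : Tendsto y l (𝓝 z)) :
    (fun k => ∇ h (y k) - ∇ h (x k) - hess h z (y k - x k)) =o[l] (fun k => y k - x k) := by
  have hs : HasStrictFDerivAt (fun x => ∇ h x) (hess h z) z :=
    (contDiff_gradient hh).contDiffAt.hasStrictFDerivAt (by norm_num)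
  have := hs.isLittleO.comp_tendsto (hy.prodMk_nhds hx)
  exact this

/-- Second order Taylor expansion of a `C²` function, along a filter. -/
theorem taylor_two_isLittleO {ι : Type*} {l : Filter ι} {h : E n → ℝ} (hh : ContDiff ℝ 2 h)
    {z : E n} {x d : ι → E n} (hx : Tendsto x l (𝓝 z)) (hd : Tendsto d l (𝓝 0)) :
    (fun k => h (x k + d k) - h (x k) - ⟪∇ h (x k), d k⟫_ℝ - 1 / 2 * ⟪d k, hess h z (d k)⟫_ℝ)
      =o[l] (fun k => ‖d k‖ ^ 2) := by
  have hs : HasStrictFDerivAt (fun x => ∇ h x) (hess h z) z :=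
    (contDiff_gradient hh).contDiffAt.hasStrictFDerivAt (by norm_num)
  rw [isLittleO_iff]
  intro c hc
  have h1 := (isLittleO_iff.1 hs.isLittleO) hc
  obtain ⟨r, hr, hball⟩ := Metric.eventually_nhds_iff_ball.1 h1
  have e1 := hx.eventually (Metric.ball_mem_nhds z (half_pos hr))
  have e2 := hd.eventually (Metric.ball_mem_nhds 0 (half_pos hr))
  filter_upwards [e1, e2] with k hk1 hk2
  set X := x k
  set D := d k
  have hX : ‖X - z‖ < r / 2 := by simpa [dist_eq_norm] using hk1
  have hD : ‖D‖ < r / 2 := by simpa [dist_eq_norm] using hk2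
  -- Up to a constant, `ψ` is the Taylor remainder along the segment. Strict differentiability of
  -- the gradient at `z` bounds its derivative for every base point near `z`, not only at `z`
  -- itself.
  let ψ : ℝ → ℝ := fun s => h (X + s • D) - s * ⟪∇ h X, D⟫_ℝ - 1 / 2 * s ^ 2 * ⟪D, hess h z D⟫_ℝ
  have hder : ∀ s : ℝ, HasDerivAt ψ
      (⟪∇ h (X + s • D) - ∇ h X - hess h z (s • D), D⟫_ℝ) s := by
    intro s
    have hline : HasDerivAt (fun s : ℝ => X + s • D) D s := by
      simpa using ((hasDerivAt_id s).smul_const D).const_add X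
    have a1 := (hasFDerivAt_of_contDiff hh (X + s • D)).comp_hasDerivAt s hline
    have a2 := (a1.sub ((hasDerivAt_id s).mul_const ⟪∇ h X, D⟫_ℝ)).sub
      ((((hasDerivAt_id s).pow 2).const_mul (1 / 2 : ℝ)).mul_const ⟪D, hess h z D⟫_ℝ)
    refine HasDerivAt.congr_deriv (f := ψ) a2 ?_
    simp only [innerSL_apply_apply, inner_sub_left, map_smul, inner_smul_left, id,
      real_inner_comm D (hess h z D)]
    simp
  have hbound : ∀ s ∈ Set.Ico (0 : ℝ) 1,
      ‖⟪∇ h (X + s • D) - ∇ h X - hess h z (s • D), D⟫_ℝ‖ ≤ c * ‖D‖ ^ 2 := by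
    intro s hs
    have hsD : ‖s • D‖ ≤ ‖D‖ := by
      rw [norm_smul, Real.norm_eq_abs, abs_of_nonneg hs.1]
      exact mul_le_of_le_one_left (norm_nonneg _) hs.2.le
    have hmem : ((X + s • D, X) : E n × E n) ∈ Metric.ball ((z, z) : E n × E n) r := by
      rw [Metric.mem_ball, Prod.dist_eq, max_lt_iff]
      constructor
      · rw [dist_eq_norm]
        calc ‖X + s • D - z‖ = ‖(X - z) + s • D‖ := by congr 1; abel
          _ ≤ ‖X - z‖ + ‖s • D‖ := norm_add_le _ _
          _ < r := by linarith
      · rw [dist_eq_norm]; simpa using hX.trans (half_lt_self hr)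
    have := hball _ hmem
    simp only [add_sub_cancel_left] at this
    calc _ ≤ ‖∇ h (X + s • D) - ∇ h X - hess h z (s • D)‖ * ‖D‖ := norm_inner_le_norm _ _
      _ ≤ (c * ‖s • D‖) * ‖D‖ := by gcongr
      _ ≤ (c * ‖D‖) * ‖D‖ := by gcongr
      _ = _ := by ring
  have := norm_image_sub_le_of_norm_deriv_le_segment_01'
    (fun s _ => (hder s).hasDerivWithinAt) hbound
  simp only [ψ, one_smul, zero_smul, add_zero] at this
  rw [Real.norm_of_nonneg (by positivity : (0 : ℝ) ≤ ‖D‖ ^ 2)]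
  refine le_trans (le_of_eq ?_) this
  congr 1
  ring

/-- A quadratic form that is positive on the nonzero vectors of a subspace `{d | ∀ j, ⟪v j, d⟫ = 0}`
becomes positive definite on adding a large multiple of `∑ ⟪v j, d⟫²`. -/
theorem exists_penalized_coercive {ι : Type*} [Fintype ι] (H : E n →L[ℝ] E n) (v : ι → E n)
    (hpos : ∀ d : E n, d ≠ 0 → (∀ j, ⟪v j, d⟫_ℝ = 0) → 0 < ⟪d, H d⟫_ℝ) :
    ∃ c C : ℝ, 0 < c ∧ 0 ≤ C ∧
      ∀ d : E n, c * ‖d‖ ^ 2 ≤ ⟪d, H d⟫_ℝ + C * ∑ j, ⟪v j, d⟫_ℝ ^ 2 := by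
  by_contra! hcon
  -- Normalized counterexamples for the penalty `N`: boundedness of the form forces the penalty sum
  -- to zero, so a limit point is a unit vector of the subspace with nonpositive form.
  have hd : ∀ N : ℕ, ∃ d : E n, ‖d‖ = 1 ∧
      ⟪d, H d⟫_ℝ + N * ∑ j, ⟪v j, d⟫_ℝ ^ 2 < 1 / ((N : ℝ) + 1) := by
    intro N
    obtain ⟨d, hd⟩ := hcon (1 / ((N : ℝ) + 1)) N (by positivity) (by positivity)
    have hd0 : d ≠ 0 := by rintro rfl; simp at hd
    have hn : 0 < ‖d‖ := norm_pos_iff.2 hd0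
    refine ⟨‖d‖⁻¹ • d, by rw [norm_smul, norm_inv, norm_norm, inv_mul_cancel₀ hn.ne'], ?_⟩
    simp only [map_smul, inner_smul_left, inner_smul_right, mul_pow, ← Finset.mul_sum]
    have hkey : ‖d‖⁻¹ ^ 2 * (⟪d, H d⟫_ℝ + N * ∑ j, ⟪v j, d⟫_ℝ ^ 2) < 1 / ((N : ℝ) + 1) := by
      rw [inv_pow, inv_mul_lt_iff₀ (by positivity), mul_comm (‖d‖ ^ 2)]; exact hd
    refine lt_of_eq_of_lt ?_ hkey
    simp
    ring
  choose d hd1 hd2 using hd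
  obtain ⟨e, he, φ, hφ, hlim⟩ := (isCompact_sphere (0 : E n) 1).tendsto_subseq
    (x := d) (fun N => by simp [hd1])
  have he1 : ‖e‖ = 1 := by simpa using he
  have hcH : Tendsto (fun N => ⟪d (φ N), H (d (φ N))⟫_ℝ) atTop (𝓝 ⟪e, H e⟫_ℝ) :=
    hlim.inner ((H.continuous.tendsto e).comp hlim)
  have hcS : Tendsto (fun N => ∑ j, ⟪v j, d (φ N)⟫_ℝ ^ 2) atTop (𝓝 (∑ j, ⟪v j, e⟫_ℝ ^ 2)) :=
    tendsto_finsetSum _ fun j _ => (tendsto_const_nhds.inner hlim).pow 2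
  have hφt : Tendsto (fun N => ((φ N : ℕ) : ℝ)) atTop atTop :=
    tendsto_natCast_atTop_atTop.comp hφ.tendsto_atTop
  have hS0 : ∀ N, 0 ≤ ∑ j, ⟪v j, d N⟫_ℝ ^ 2 := fun N => Finset.sum_nonneg fun j _ => sq_nonneg _
  have hle1 : ∀ N : ℕ, (1 : ℝ) / ((N : ℝ) + 1) ≤ 1 := fun N => by
    rw [div_le_one (by positivity)]; simp
  have hzero : ∑ j, ⟪v j, e⟫_ℝ ^ 2 = 0 := by
    have hb : ∀ N, |⟪d N, H (d N)⟫_ℝ| ≤ ‖H‖ := fun N => by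
      calc _ ≤ ‖d N‖ * ‖H (d N)‖ := abs_real_inner_le_norm _ _
        _ ≤ 1 * (‖H‖ * 1) := by
          rw [hd1]; gcongr; simpa [hd1] using H.le_opNorm (d N)
        _ = _ := by ring
    have hz : Tendsto (fun N => ∑ j, ⟪v j, d (φ N)⟫_ℝ ^ 2) atTop (𝓝 0) := by
      have hup : Tendsto (fun N => (1 + ‖H‖) / ((φ N : ℕ) : ℝ)) atTop (𝓝 0) :=
        tendsto_const_nhds.div_atTop hφt
      refine squeeze_zero' (Eventually.of_forall fun N => hS0 _) ?_ hup
      filter_upwards [hφt.eventually_gt_atTop 0] with N hN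
      rw [le_div_iff₀ hN]
      have := hd2 (φ N)
      have := hle1 (φ N)
      have := neg_le_of_abs_le (hb (φ N))
      linarith
    exact tendsto_nhds_unique hcS hz
  have hperp : ∀ j, ⟪v j, e⟫_ℝ = 0 := fun j => by
    have := (Finset.sum_eq_zero_iff_of_nonneg (fun j _ => sq_nonneg ⟪v j, e⟫_ℝ)).1 hzero j
      (Finset.mem_univ j)
    exact pow_eq_zero_iff (two_ne_zero) |>.1 this
  have hlt := hpos e (by rintro rfl; simp at he1) hperp
  have hle : ⟪e, H e⟫_ℝ ≤ 0 := by
    refine le_of_tendsto_of_tendsto' hcH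
      ((tendsto_one_div_add_atTop_nhds_zero_nat (𝕜 := ℝ)).comp hφ.tendsto_atTop) fun N => ?_
    have h1 := hd2 (φ N)
    have h2 : 0 ≤ ((φ N : ℕ) : ℝ) * ∑ j, ⟪v j, d (φ N)⟫_ℝ ^ 2 :=
      mul_nonneg (Nat.cast_nonneg _) (hS0 _)
    simp only [Function.comp]
    linarith
  linarith

namespace Problem

/-! ### Constraint violation, uniform independence, and the block linear system. -/

section

variable {P : Problem n m}

theorem phi_nonneg (P : Problem n m) (x : E n) : 0 ≤ P.phi x :=
  ((Finset.fold_max_le (P.phi x)).1 le_rfl).1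

theorem le_phi (P : Problem n m) (j : Fin m) (x : E n) : P.f j x ≤ P.phi x :=
  ((Finset.fold_max_le (P.phi x)).1 le_rfl).2 j (Finset.mem_univ j)

theorem phi_le {x : E n} {c : ℝ} (hc : 0 ≤ c) (h : ∀ j, P.f j x ≤ c) : P.phi x ≤ c :=
  (Finset.fold_max_le c).2 ⟨hc, fun j _ => h j⟩

theorem phi_eq_zero_iff {x : E n} : P.phi x = 0 ↔ ∀ j, P.f j x ≤ 0 :=
  ⟨fun h j => h ▸ P.le_phi j x, fun h => le_antisymm (phi_le le_rfl h) (P.phi_nonneg x)⟩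

theorem exists_phi_le_of_pos {x : E n} (h : 0 < P.phi x) : ∃ j, P.phi x ≤ P.f j x := by
  rcases (Finset.le_fold_max (P.phi x)).1 (le_refl (P.phi x)) with h0 | ⟨j, _, hj⟩
  · exact absurd h0 (not_le.2 h)
  · exact ⟨j, hj⟩

theorem continuous_phi (hf : ∀ j, Continuous (P.f j)) : Continuous P.phi := by
  have : ∀ s : Finset (Fin m), Continuous fun x => s.fold max 0 (fun j => P.f j x) := by
    intro s
    induction s using Finset.induction_on with
    | empty => simpa using continuous_const
    | insert j s hj ih =>
      simp only [Finset.fold_insert hj]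
      exact (hf j).max ih
  exact this _

theorem fbar_nonpos (P : Problem n m) (j : Fin m) (x : E n) : P.fbar j x ≤ 0 := by
  unfold fbar
  split_ifs with h
  · exact h
  · exact sub_nonpos.2 (P.le_phi j x)

theorem fbar_of_nonpos {j : Fin m} {x : E n} (h : P.f j x ≤ 0) : P.fbar j x = P.f j x := if_pos h

theorem fbar_of_pos {j : Fin m} {x : E n} (h : 0 < P.f j x) :
    P.fbar j x = P.f j x - P.phi x := if_neg (not_le.2 h)

theorem abs_fbar (P : Problem n m) (j : Fin m) (x : E n) : |P.fbar j x| = -P.fbar j x :=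
  abs_of_nonpos (P.fbar_nonpos j x)

/-- `fbar j` may jump where `f j` vanishes, so closedness of activity is checked by the sign of `f j
z`. At a zero of `f j` the index is active by definition; elsewhere `fbar j` is locally given by one
continuous formula. -/
theorem mem_activeSet_of_tendsto {ι : Type*} {l : Filter ι} [l.NeBot]
    (hf : ∀ j, Continuous (P.f j)) {y : ι → E n} {z : E n} {j : Fin m} (hy : Tendsto y l (𝓝 z))
    (h : Tendsto (fun k => P.fbar j (y k)) l (𝓝 0)) : j ∈ P.activeSet z := by
  have hfy := ((hf j).tendsto z).comp hy
  have hpy := ((continuous_phi hf).tendsto z).comp hy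
  show P.fbar j z = 0
  rcases lt_trichotomy (P.f j z) 0 with hneg | hzero | hpos
  · have : Tendsto (fun k => P.f j (y k)) l (𝓝 0) := by
      refine h.congr' ?_
      filter_upwards [hfy.eventually (gt_mem_nhds hneg)] with k hk
      exact fbar_of_nonpos hk.le
    exact absurd (tendsto_nhds_unique hfy this) hneg.ne
  · rw [fbar_of_nonpos hzero.le, hzero]
  · have : Tendsto (fun k => P.f j (y k) - P.phi (y k)) l (𝓝 0) := by
      refine h.congr' ?_
      filter_upwards [hfy.eventually (lt_mem_nhds hpos)] with k hk
      exact fbar_of_pos hk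
    rw [fbar_of_pos hpos]
    exact tendsto_nhds_unique (hfy.sub hpy) this

/-- Quantitative linear independence of the gradients, uniformly on a compact set: a vector of
coefficients is controlled by the combination of the gradients and by its inactive part. -/
theorem exists_norm_le_of_gradientsIndependent (hP : P.GradientsIndependent)
    (hf : ∀ j, ContDiff ℝ 2 (P.f j)) {K : Set (E n)} (hK : IsCompact K) :
    ∃ C : ℝ, 0 < C ∧ ∀ x ∈ K, ∀ h : Fin m → ℝ,
      ‖h‖ ≤ C * (‖∑ j, h j • P.g j x‖ + ∑ j, |P.fbar j x| * |h j|) := by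
  by_contra! hcon
  have hseq : ∀ N : ℕ, ∃ y ∈ K, ∃ h : Fin m → ℝ, ‖h‖ = 1 ∧
      ‖∑ j, h j • P.g j y‖ + ∑ j, |P.fbar j y| * |h j| < 1 / ((N : ℝ) + 1) := by
    intro N
    obtain ⟨y, hy, h, hh⟩ := hcon ((N : ℝ) + 1) (by positivity)
    have hn : 0 < ‖h‖ := lt_of_le_of_lt (by positivity) hh
    refine ⟨y, hy, ‖h‖⁻¹ • h, by rw [norm_smul, norm_inv, norm_norm, inv_mul_cancel₀ hn.ne'], ?_⟩
    have e1 : ∑ j, (‖h‖⁻¹ • h) j • P.g j y = ‖h‖⁻¹ • ∑ j, h j • P.g j y := by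
      simp [Finset.smul_sum, smul_smul]
    have e2 : ∑ j, |P.fbar j y| * |(‖h‖⁻¹ • h) j| = ‖h‖⁻¹ * ∑ j, |P.fbar j y| * |h j| := by
      rw [Finset.mul_sum]
      refine Finset.sum_congr rfl fun j _ => ?_
      simp [abs_mul]
      ring
    rw [e1, e2, norm_smul, norm_inv, norm_norm, ← mul_add, inv_mul_lt_iff₀ hn, mul_one_div,
      lt_div_iff₀ (by positivity), mul_comm]
    exact hh
  choose y hy h hh1 hh2 using hseq
  obtain ⟨⟨z, e⟩, ⟨hz, he⟩, φ, hφ, hlim⟩ := (hK.prod (isCompact_sphere (0 : Fin m → ℝ) 1)).tendsto_subseq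
    (x := fun N => (y N, h N)) (fun N => ⟨hy N, by simp [hh1]⟩)
  have hyl : Tendsto (fun N => y (φ N)) atTop (𝓝 z) := (continuous_fst.tendsto _).comp hlim
  have hhl : Tendsto (fun N => h (φ N)) atTop (𝓝 e) := (continuous_snd.tendsto _).comp hlim
  have hhj : ∀ j, Tendsto (fun N => h (φ N) j) atTop (𝓝 (e j)) := fun j =>
    (tendsto_pi_nhds.1 hhl) j
  have hto : Tendsto (fun N => 1 / (((φ N : ℕ) : ℝ) + 1)) atTop (𝓝 0) :=
    (tendsto_one_div_add_atTop_nhds_zero_nat (𝕜 := ℝ)).comp hφ.tendsto_atTop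
  have hsum : ∑ j, e j • P.g j z = 0 := by
    have h1 : Tendsto (fun N => ∑ j, h (φ N) j • P.g j (y (φ N))) atTop
        (𝓝 (∑ j, e j • P.g j z)) :=
      tendsto_finsetSum _ fun j _ => (hhj j).smul
        (((contDiff_gradient (hf j)).continuous.tendsto z).comp hyl)
    refine tendsto_nhds_unique h1 (squeeze_zero_norm (fun N => ?_) hto)
    have := hh2 (φ N)
    have : 0 ≤ ∑ j, |P.fbar j (y (φ N))| * |h (φ N) j| :=
      Finset.sum_nonneg fun j _ => by positivity
    linarith
  -- The weighted term tends to zero while `|h j|` stays away from zero, so `fbar j` tends to zero.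
  -- The limit coefficients are thus supported on the active set, where independence applies.
  have hact : ∀ j, e j ≠ 0 → j ∈ P.activeSet z := by
    intro j hj
    refine mem_activeSet_of_tendsto (fun j => (hf j).continuous) hyl ?_
    have h1 : Tendsto (fun N => |P.fbar j (y (φ N))| * |h (φ N) j|) atTop (𝓝 0) := by
      refine squeeze_zero (fun N => by positivity) (fun N => ?_) hto
      have h2 := hh2 (φ N)
      have h3 : |P.fbar j (y (φ N))| * |h (φ N) j| ≤ ∑ j, |P.fbar j (y (φ N))| * |h (φ N) j| :=
        Finset.single_le_sum (f := fun j => |P.fbar j (y (φ N))| * |h (φ N) j|)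
          (fun j _ => by positivity) (Finset.mem_univ j)
      have h4 := norm_nonneg (∑ j, h (φ N) j • P.g j (y (φ N)))
      linarith
    have h2 := h1.div (hhj j).abs (abs_ne_zero.2 hj)
    rw [zero_div] at h2
    rw [tendsto_zero_iff_abs_tendsto_zero]
    refine h2.congr' ?_
    filter_upwards [(hhj j).eventually_ne hj] with N hN
    simp only [Function.comp, Pi.div_apply]
    field_simp
  classical
  have hsum' : ∑ j : P.activeSet z, e j • P.g j z = 0 := by
    rw [← hsum]
    refine (Finset.sum_congr_set (P.activeSet z) (fun j => e j • P.g j z)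
      (fun j => e j • P.g j z) (fun _ _ => rfl) fun j hj => ?_).symm
    have : e j = 0 := by
      by_contra h
      exact hj (hact j h)
    simp [this]
  have he0 : e = 0 := by
    funext j
    by_contra hj
    exact hj ((Fintype.linearIndependent_iff.1 (hP z)) (fun j => e j) hsum' ⟨j, hact j hj⟩)
  simp [he0] at he

/-- A symmetric matrix whose quadratic form lies between `0` and `b ‖d‖²` has norm at most `b`. -/
theorem norm_act_le {B : Matrix (Fin n) (Fin n) ℝ} (hB : B.PosDef) {b : ℝ} (hb : 0 < b)
    (h : ∀ d : E n, ⟪d, act B d⟫_ℝ ≤ b * ‖d‖ ^ 2) (d : E n) : ‖act B d‖ ≤ b * ‖d‖ := by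
  have hsymm : ∀ u v : E n, ⟪u, act B v⟫_ℝ = ⟪act B u, v⟫_ℝ := fun u v =>
    ((Matrix.isSymmetric_toEuclideanLin_iff.2 hB.isHermitian) u v).symm
  have hpos : ∀ v : E n, 0 ≤ ⟪v, act B v⟫_ℝ := by
    intro v
    have := hB.posSemidef.dotProduct_mulVec_nonneg v.ofLp
    simpa [act, Matrix.toLpLin_apply, PiLp.inner_apply, dotProduct, mul_comm] using this
  have hadd : ∀ u v : E n, act B (u - v) = act B u - act B v := fun u v => map_sub _ u v
  have hsm : ∀ (c : ℝ) (u : E n), act B (c • u) = c • act B u := fun c u => map_smul _ c u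
  set e := act B d with he
  -- Nonnegativity of the form at `d - b⁻¹ • B d`, expanded using symmetry, bounds `‖B d‖²` without
  -- spectral theory.
  have h1 := hpos (d - b⁻¹ • e)
  have h2 := h e
  have h3 := h d
  rw [hadd, hsm, ← he] at h1
  simp only [inner_sub_left, inner_sub_right, inner_smul_left, inner_smul_right, conj_trivial] at h1
  rw [hsymm d e, ← he, real_inner_self_eq_norm_sq] at h1
  have h4 : b⁻¹ * (b⁻¹ * ⟪e, act B e⟫_ℝ) ≤ b⁻¹ * ‖e‖ ^ 2 := by
    refine mul_le_mul_of_nonneg_left ?_ (by positivity)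
    rw [inv_mul_le_iff₀ hb]
    exact h2
  have h5 : b⁻¹ * ‖e‖ ^ 2 ≤ b * ‖d‖ ^ 2 := by linarith
  rw [inv_mul_le_iff₀ hb] at h5
  exact le_of_sq_le_sq (by nlinarith) (by positivity)

/-- The bracket in `diag` dominates `|fbar j|` up to `G` by the triangle inequality. Hence the
diagonal block, although it may vanish, controls exactly the weighted components in the independence
estimate. -/
theorem le_diag (P : Problem n m) {x d : E n} {j : Fin m} {G : ℝ} (hG : 1 ≤ G) (hg : ‖P.g j x‖ ≤ G) :
    P.fbar j x ^ 2 ≤ G * P.diag x d j := by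
  have h1 : |P.fbar j x| ≤ G * (|P.fbar j x + ⟪P.g j x, d⟫_ℝ| + ‖d‖) := by
    have h2 : |⟪P.g j x, d⟫_ℝ| ≤ G * ‖d‖ :=
      (abs_real_inner_le_norm _ _).trans (by gcongr)
    have h3 : |P.fbar j x| ≤ |P.fbar j x + ⟪P.g j x, d⟫_ℝ| + |⟪P.g j x, d⟫_ℝ| := by
      simpa using abs_sub (P.fbar j x + ⟪P.g j x, d⟫_ℝ) ⟪P.g j x, d⟫_ℝ
    have h4 := le_mul_of_one_le_left (abs_nonneg (P.fbar j x + ⟪P.g j x, d⟫_ℝ)) hG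
    linarith
  rw [← sq_abs, sq, diag]
  calc _ ≤ |P.fbar j x| * (G * (|P.fbar j x + ⟪P.g j x, d⟫_ℝ| + ‖d‖)) := by gcongr
    _ = _ := by ring

theorem diag_nonneg (P : Problem n m) (x d : E n) (j : Fin m) : 0 ≤ P.diag x d j := by
  unfold diag; positivity

/-- Pairing the first block with `d` and substituting the second gives the energy identity `⟪d, B d⟫
+ ∑ D j * h j ^ 2 = -∑ h j * r j`. Its right side, at most `m * ‖h‖ * R`, bounds both terms of the
independence estimate squared; one factor `‖h‖` then cancels. -/
theorem norm_le_of_solvesSLE {x d₀ : E n} {B : Matrix (Fin n) (Fin n) ℝ} {a b C G : ℝ}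
    (ha : 0 < a) (hC : 0 < C) (hG : 1 ≤ G) (hg : ∀ j, ‖P.g j x‖ ≤ G)
    (hcoer : ∀ d : E n, a * ‖d‖ ^ 2 ≤ ⟪d, act B d⟫_ℝ) (hb : ∀ d : E n, ‖act B d‖ ≤ b * ‖d‖)
    (hli : ∀ h : Fin m → ℝ, ‖h‖ ≤ C * (‖∑ j, h j • P.g j x‖ + ∑ j, |P.fbar j x| * |h j|))
    {r : Fin m → ℝ} {d : E n} {h : Fin m → ℝ} {R : ℝ} (hR : 0 ≤ R) (hr : ∀ j, |r j| ≤ R)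
    (hs : P.SolvesSLE x B d₀ r d h) :
    ‖h‖ ≤ 2 * C ^ 2 * (b ^ 2 / a + m * G) * m * R ∧
      a * ‖d‖ ^ 2 ≤ m * ‖h‖ * R := by
  obtain ⟨h1, h2⟩ := hs
  have hhj : ∀ j, |h j| ≤ ‖h‖ := fun j => norm_le_pi_norm h j
  have hen : ⟪d, act B d⟫_ℝ + ∑ j, P.diag x d₀ j * h j ^ 2 = -∑ j, h j * r j := by
    have e1 : ⟪d, act B d + ∑ j, h j • P.g j x⟫_ℝ = 0 := by rw [h1, inner_zero_right]
    rw [inner_add_right, inner_sum] at e1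
    have e2 : ∑ j, ⟪d, h j • P.g j x⟫_ℝ = ∑ j, P.diag x d₀ j * h j ^ 2 + ∑ j, h j * r j := by
      rw [← Finset.sum_add_distrib]
      refine Finset.sum_congr rfl fun j _ => ?_
      rw [inner_smul_right, real_inner_comm, ← h2 j]
      ring
    linarith
  have hrhs : -∑ j, h j * r j ≤ m * ‖h‖ * R := by
    rw [← Finset.sum_neg_distrib]
    calc ∑ j, -(h j * r j) ≤ ∑ _j : Fin m, ‖h‖ * R := by
          refine Finset.sum_le_sum fun j _ => ?_
          calc -(h j * r j) ≤ |h j * r j| := neg_le_abs _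
            _ = |h j| * |r j| := abs_mul _ _
            _ ≤ ‖h‖ * R := by gcongr; exacts [hhj j, hr j]
      _ = _ := by simp; ring
  have hDnn : 0 ≤ ∑ j, P.diag x d₀ j * h j ^ 2 :=
    Finset.sum_nonneg fun j _ => mul_nonneg (P.diag_nonneg _ _ _) (sq_nonneg _)
  have hco := hcoer d
  refine ⟨?_, by linarith⟩
  set T := m * ‖h‖ * R with hT
  have hT0 : 0 ≤ T := by positivity
  have hd : ‖d‖ ^ 2 ≤ T / a := by rw [le_div_iff₀ ha]; linarith
  have hBd : ‖act B d‖ ^ 2 ≤ b ^ 2 / a * T := by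
    calc ‖act B d‖ ^ 2 ≤ (b * ‖d‖) ^ 2 := by gcongr; exact hb d
      _ = b ^ 2 * ‖d‖ ^ 2 := by ring
      _ ≤ b ^ 2 * (T / a) := by gcongr
      _ = _ := by ring
  have hS : (∑ j, |P.fbar j x| * |h j|) ^ 2 ≤ m * G * T := by
    calc (∑ j, |P.fbar j x| * |h j|) ^ 2
        ≤ (Finset.univ : Finset (Fin m)).card * ∑ j, (|P.fbar j x| * |h j|) ^ 2 :=
          sq_sum_le_card_mul_sum_sq
      _ ≤ m * ∑ j, G * (P.diag x d₀ j * h j ^ 2) := by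
          rw [Finset.card_univ, Fintype.card_fin]
          gcongr with j
          rw [mul_pow, sq_abs, sq_abs, ← mul_assoc]
          gcongr
          exact P.le_diag hG (hg j)
      _ ≤ m * (G * T) := by
          rw [← Finset.mul_sum]
          have := mul_nonneg ha.le (sq_nonneg ‖d‖)
          gcongr
          linarith
      _ = _ := by ring
  have hsum : ∑ j, h j • P.g j x = -act B d := eq_neg_of_add_eq_zero_right h1
  have hn := hli h
  rw [hsum, norm_neg] at hn
  have hsq : ‖h‖ ^ 2 ≤ 2 * C ^ 2 * (b ^ 2 / a + m * G) * T := by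
    calc ‖h‖ ^ 2 ≤ (C * (‖act B d‖ + ∑ j, |P.fbar j x| * |h j|)) ^ 2 := by gcongr
      _ = C ^ 2 * (‖act B d‖ + ∑ j, |P.fbar j x| * |h j|) ^ 2 := by ring
      _ ≤ C ^ 2 * (2 * (‖act B d‖ ^ 2 + (∑ j, |P.fbar j x| * |h j|) ^ 2)) := by
          gcongr; exact add_sq_le
      _ ≤ C ^ 2 * (2 * (b ^ 2 / a * T + m * G * T)) := by gcongr
      _ = _ := by ring
  rcases (norm_nonneg h).eq_or_lt with h0 | h0
  · rw [← h0]; positivity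
  · refine le_of_mul_le_mul_right ?_ h0
    calc ‖h‖ * ‖h‖ = ‖h‖ ^ 2 := by ring
      _ ≤ _ := hsq
      _ = _ := by rw [hT]; ring

end

/-! ### Uniform bounds along the run. -/

section

variable {P : Problem n m}

/-- Stationarity paired with `d`, where complementarity turns `lam j * ⟪g j, d⟫` into `|fbar j| *
|lam j|`. This yields at once the descent property, the bound on `d₀`, and the inactive part of the
multiplier. -/
theorem IsQPMultiplier.sum_mul_abs_fbar {x d : E n} {B : Matrix (Fin n) (Fin n) ℝ}
    {lam : Fin m → ℝ} (h : P.IsQPMultiplier x B d lam) :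
    ⟪P.g₀ x, d⟫_ℝ + ⟪d, act B d⟫_ℝ + ∑ j, |P.fbar j x| * |lam j| = 0 := by
  have h1 : ⟪P.g₀ x + act B d + ∑ j, lam j • P.g j x, d⟫_ℝ = 0 := by
    rw [h.stationary, inner_zero_left]
  rw [inner_add_left, inner_add_left, sum_inner, real_inner_comm d (act B d)] at h1
  rw [← h1]
  congr 1
  refine Finset.sum_congr rfl fun j _ => ?_
  rw [abs_fbar, abs_of_nonneg (h.nonneg j), inner_smul_left, conj_trivial]
  have := h.complementary j
  linarith

/-- The bounds, with constants `a` and `M`, on the data of an iteration of the algorithm that are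
used in its analysis. -/
structure IterBounds (P : Problem n m) (a M : ℝ) (x : E n) (B : Matrix (Fin n) (Fin n) ℝ)
    (d₀ : E n) (lam : Fin m → ℝ) : Prop where
  g₀_le : ‖P.g₀ x‖ ≤ M
  g_le : ∀ j, ‖P.g j x‖ ≤ M
  fbar_le : ∀ j, |P.fbar j x| ≤ M
  phi_le : P.phi x ≤ M
  d₀_le : ‖d₀‖ ≤ M
  lam_le : ‖lam‖ ≤ M
  act_le : ∀ d : E n, ‖act B d‖ ≤ M * ‖d‖
  descent : ⟪P.g₀ x, d₀⟫_ℝ ≤ -(a * ‖d₀‖ ^ 2)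
  independent : ∀ h : Fin m → ℝ,
    ‖h‖ ≤ M * (‖∑ j, h j • P.g j x‖ + ∑ j, |P.fbar j x| * |h j|)
  sle : ∀ (r : Fin m → ℝ) (d : E n) (h : Fin m → ℝ) (R : ℝ), 0 ≤ R → (∀ j, |r j| ≤ R) →
    P.SolvesSLE x B d₀ r d h → ‖d‖ ≤ M * R ∧ ‖h‖ ≤ M * R

theorem exists_iterBounds {p : Params} {x : ℕ → E n} {B : ℕ → Matrix (Fin n) (Fin n) ℝ}
    {d₀ : ℕ → E n} {lam : ℕ → Fin m → ℝ} {d₁ : ℕ → E n}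
    (hrun : P.IsRun p x B d₀ lam d₁) (hindep : P.GradientsIndependent) (hB : UniformlyPosDef B)
    (hf₀ : ContDiff ℝ 2 P.f₀) (hf : ∀ j, ContDiff ℝ 2 (P.f j))
    (hbdd : Bornology.IsBounded (Set.range x)) :
    ∃ a M : ℝ, 0 < a ∧ 1 ≤ M ∧ ∀ k, P.IterBounds a M (x k) (B k) (d₀ k) (lam k) := by
  obtain ⟨a, b, ha, hb, hab⟩ := hB
  have hK : IsCompact (closure (Set.range x)) := hbdd.isCompact_closure
  have hxK : ∀ k, x k ∈ closure (Set.range x) := fun k => subset_closure ⟨k, rfl⟩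
  obtain ⟨C, hC, hli⟩ := exists_norm_le_of_gradientsIndependent hindep hf hK
  obtain ⟨G₀, hG₀⟩ := hK.exists_bound_of_continuousOn
    (contDiff_gradient hf₀).continuous.continuousOn
  have hgj : ∀ j, ∃ G : ℝ, ∀ k, ‖P.g j (x k)‖ ≤ G := fun j => by
    obtain ⟨G, hG⟩ := hK.exists_bound_of_continuousOn
      (contDiff_gradient (hf j)).continuous.continuousOn
    exact ⟨G, fun k => hG _ (hxK k)⟩
  choose Gj hGj using hgj
  have hfj : ∀ j, ∃ G : ℝ, ∀ k, |P.f j (x k)| ≤ G := fun j => by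
    obtain ⟨G, hG⟩ := hK.exists_bound_of_continuousOn (hf j).continuous.continuousOn
    exact ⟨G, fun k => hG _ (hxK k)⟩
  choose Fj hFj using hfj
  obtain ⟨Φ, hΦ⟩ := hK.exists_bound_of_continuousOn
    (continuous_phi fun j => (hf j).continuous).continuousOn
  have hGj0 : ∀ j, 0 ≤ Gj j := fun j => (norm_nonneg _).trans (hGj j 0)
  have hFj0 : ∀ j, 0 ≤ Fj j := fun j => (abs_nonneg _).trans (hFj j 0)
  have hG₀0 : 0 ≤ G₀ := (norm_nonneg _).trans (hG₀ _ (hxK 0))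
  have hΦ0 : 0 ≤ Φ := (norm_nonneg _).trans (hΦ _ (hxK 0))
  set G : ℝ := 1 + ∑ j, Gj j with hGdef
  have hG1 : 1 ≤ G := by
    have : 0 ≤ ∑ j, Gj j := Finset.sum_nonneg fun j _ => hGj0 j
    linarith
  have hgG : ∀ k j, ‖P.g j (x k)‖ ≤ G := fun k j => by
    have := Finset.single_le_sum (f := Gj) (fun j _ => hGj0 j) (Finset.mem_univ j)
    linarith [hGj j k]
  have hphi : ∀ k, P.phi (x k) ≤ Φ := fun k => (le_abs_self _).trans (hΦ _ (hxK k))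
  have hfbar : ∀ k j, |P.fbar j (x k)| ≤ (∑ j, Fj j) + Φ := fun k j => by
    have h1 := Finset.single_le_sum (f := Fj) (fun j _ => hFj0 j) (Finset.mem_univ j)
    have h2 := abs_le.1 (hFj j k)
    have h3 := hphi k
    have h4 := P.phi_nonneg (x k)
    rw [abs_fbar]
    unfold fbar
    split_ifs <;> linarith
  have hact : ∀ k (d : E n), ‖act (B k) d‖ ≤ b * ‖d‖ := fun k =>
    norm_act_le (hrun.posDef k) hb fun d => (hab k d).2
  have hdesc : ∀ k, ⟪P.g₀ (x k), d₀ k⟫_ℝ ≤ -(a * ‖d₀ k‖ ^ 2) := fun k => by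
    have h1 := (hrun.multiplier k).sum_mul_abs_fbar
    have h2 := (hab k (d₀ k)).1
    have h3 : 0 ≤ ∑ j, |P.fbar j (x k)| * |lam k j| :=
      Finset.sum_nonneg fun j _ => by positivity
    linarith
  have hg₀d : ∀ k, -⟪P.g₀ (x k), d₀ k⟫_ℝ ≤ G₀ * ‖d₀ k‖ := fun k =>
    (neg_le_abs _).trans ((abs_real_inner_le_norm _ _).trans (by gcongr; exact hG₀ _ (hxK k)))
  have hd₀ : ∀ k, ‖d₀ k‖ ≤ G₀ / a := fun k => by
    rw [le_div_iff₀ ha]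
    rcases (norm_nonneg (d₀ k)).eq_or_lt with h0 | h0
    · rw [← h0]; simpa using hG₀0
    · refine le_of_mul_le_mul_right ?_ h0
      have := hdesc k
      have := hg₀d k
      nlinarith
  have hlam : ∀ k, ‖lam k‖ ≤ C * ((G₀ + b * (G₀ / a)) + G₀ * (G₀ / a)) := fun k => by
    refine (hli _ (hxK k) (lam k)).trans ?_
    have h1 := (hrun.multiplier k).sum_mul_abs_fbar
    have h2 := (hab k (d₀ k)).1
    have h3 : 0 ≤ a * ‖d₀ k‖ ^ 2 := by positivity
    have h4 : ∑ j, lam k j • P.g j (x k) = -(P.g₀ (x k) + act (B k) (d₀ k)) :=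
      eq_neg_of_add_eq_zero_right (hrun.multiplier k).stationary
    gcongr
    · rw [h4, norm_neg]
      refine (norm_add_le _ _).trans (add_le_add (hG₀ _ (hxK k)) ((hact k _).trans ?_))
      gcongr
      exact hd₀ k
    · calc _ ≤ G₀ * ‖d₀ k‖ := by linarith [hg₀d k]
        _ ≤ _ := by gcongr; exact hd₀ k
  set A := 2 * C ^ 2 * (b ^ 2 / a + m * G) * m with hA
  have hA0 : 0 ≤ A := by positivity
  have hsle : ∀ k (r : Fin m → ℝ) (d : E n) (h : Fin m → ℝ) (R : ℝ), 0 ≤ R → (∀ j, |r j| ≤ R) →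
      P.SolvesSLE (x k) (B k) (d₀ k) r d h → ‖d‖ ≤ (m * A / a + 1) * R ∧ ‖h‖ ≤ A * R := by
    intro k r d h R hR hr hs
    obtain ⟨h1, h2⟩ := norm_le_of_solvesSLE ha hC hG1 (hgG k) (fun d => (hab k d).1) (hact k)
      (hli _ (hxK k)) hR hr hs
    refine ⟨?_, h1⟩
    have h3 : ‖d‖ ^ 2 ≤ (m * A / a) * R ^ 2 := by
      have : ‖d‖ ^ 2 ≤ m * ‖h‖ * R / a := by rw [le_div_iff₀ ha]; linarith
      refine this.trans ?_
      calc m * ‖h‖ * R / a ≤ m * (A * R) * R / a := by gcongr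
        _ = _ := by ring
    -- The constant `y + 1` replaces the square root of `y = m * A / a`, since `y ≤ (y + 1) ^ 2`.
    have h4 : 0 ≤ m * A / a := by positivity
    refine le_of_sq_le_sq (h3.trans ?_) (by positivity)
    rw [mul_pow]
    gcongr
    nlinarith
  set M := 1 + G₀ + G + ((∑ j, Fj j) + Φ) + Φ + G₀ / a +
    C * ((G₀ + b * (G₀ / a)) + G₀ * (G₀ / a)) + b + C + (m * A / a + 1) + A with hM
  have n1 : 0 ≤ ∑ j, Fj j := Finset.sum_nonneg fun j _ => hFj0 j
  have n2 : 0 ≤ G₀ / a := by positivity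
  have n3 : 0 ≤ C * ((G₀ + b * (G₀ / a)) + G₀ * (G₀ / a)) := by positivity
  have n4 : 0 ≤ m * A / a := by positivity
  refine ⟨a, M, ha, by linarith, fun k => ?_⟩
  constructor
  · exact (hG₀ _ (hxK k)).trans (by linarith)
  · exact fun j => (hgG k j).trans (by linarith)
  · exact fun j => (hfbar k j).trans (by linarith)
  · exact (hphi k).trans (by linarith)
  · exact (hd₀ k).trans (by linarith)
  · exact (hlam k).trans (by linarith)
  · exact fun d => (hact k d).trans (mul_le_mul_of_nonneg_right (by linarith) (norm_nonneg _))
  · exact hdesc k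
  · exact fun h => (hli _ (hxK k) h).trans
      (mul_le_mul_of_nonneg_right (by linarith) (by positivity))
  · intro r d h R hR hr hs
    obtain ⟨h1, h2⟩ := hsle k r d h R hR hr hs
    exact ⟨h1.trans (mul_le_mul_of_nonneg_right (by linarith) hR),
      h2.trans (mul_le_mul_of_nonneg_right (by linarith) hR)⟩

/-- Bounds on the first order Taylor expansion of `h` around the points near `x`, for steps of
length at most `r`. -/
def TaylorBound (h : E n → ℝ) (L r : ℝ) (x : E n) : Prop :=
  ∀ d e : E n, ‖d‖ ≤ r → ‖e‖ ≤ r →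
    |h (x + e) - h (x + d) - ⟪∇ h (x + d), e - d⟫_ℝ| ≤ L * ‖e - d‖ ^ 2 ∧
    ‖∇ h (x + d) - ∇ h x‖ ≤ L * ‖d‖

theorem exists_taylorBound {x : ℕ → E n} (hf₀ : ContDiff ℝ 2 P.f₀)
    (hf : ∀ j, ContDiff ℝ 2 (P.f j)) (hbdd : Bornology.IsBounded (Set.range x)) {r : ℝ}
    (hr : 0 ≤ r) :
    ∃ L : ℝ, 0 < L ∧ ∀ k, TaylorBound P.f₀ L r (x k) ∧ ∀ j, TaylorBound (P.f j) L r (x k) := by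
  obtain ⟨R, hR⟩ := hbdd.exists_norm_le
  have hRk : ∀ k, ‖x k‖ ≤ R := fun k => hR _ ⟨k, rfl⟩
  have key : ∀ h : E n → ℝ, ContDiff ℝ 2 h →
      ∃ L : ℝ, 0 ≤ L ∧ ∀ L', L ≤ L' → ∀ k, TaylorBound h L' r (x k) := by
    intro h hh
    obtain ⟨L, hL⟩ := exists_taylor_bound hh (R + r)
    refine ⟨|L|, abs_nonneg _, fun L' hL' k d e hd he => ?_⟩
    have mem : ∀ d : E n, ‖d‖ ≤ r → x k + d ∈ Metric.closedBall (0 : E n) (R + r) := fun d hd => by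
      simpa using (norm_add_le _ _).trans (add_le_add (hRk k) hd)
    have m0 : x k ∈ Metric.closedBall (0 : E n) (R + r) := by
      simpa using mem 0 (by simpa using hr)
    have hLL : L ≤ L' := (le_abs_self L).trans hL'
    constructor
    · have := (hL _ (mem d hd) _ (mem e he)).2.2
      rw [add_sub_add_left_eq_sub] at this
      exact this.trans (by gcongr)
    · have := (hL _ m0 _ (mem d hd)).2.1
      rw [add_sub_cancel_left] at this
      exact this.trans (by gcongr)
  obtain ⟨L₀, hL₀, h₀⟩ := key _ hf₀
  choose Lj hLj hj using fun j => key _ (hf j)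
  have hs : 0 ≤ ∑ j, Lj j := Finset.sum_nonneg fun j _ => hLj j
  refine ⟨1 + L₀ + ∑ j, Lj j, by linarith, fun k => ⟨h₀ _ (by linarith) k, fun j => hj j _ ?_ k⟩⟩
  have := Finset.single_le_sum (f := Lj) (fun j _ => hLj j) (Finset.mem_univ j)
  linarith

end

/-! ### The weight `β`, the direction `q`, and acceptance by the second line search. -/

section

variable {P : Problem n m}

/-- The last bound uses `θ < σ`: the slack `φ ^ θ` in the objective tests absorbs errors of order `φ
^ σ`. -/
theorem rpow_bounds (P : Problem n m) {p : Params} (hp : p.Admissible) {x : E n} {M : ℝ}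
    (hM : 1 ≤ M) (h : P.phi x ≤ M) :
    0 ≤ P.phi x ^ p.σ ∧ P.phi x ^ p.σ ≤ M ∧ P.phi x ^ p.σ ≤ M * P.phi x ^ p.θ := by
  have h0 := P.phi_nonneg x
  have hθ := hp.θ_pos
  have h1 := hp.θ_lt
  have h2 := hp.σ_lt
  refine ⟨Real.rpow_nonneg h0 _, ?_, ?_⟩
  · calc P.phi x ^ p.σ ≤ M ^ p.σ := Real.rpow_le_rpow h0 h (by linarith)
      _ ≤ M ^ (1 : ℝ) := Real.rpow_le_rpow_of_exponent_le hM h2.le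
      _ = M := Real.rpow_one M
  · have e : p.σ = (p.σ - p.θ) + p.θ := by ring
    rw [e, Real.rpow_add_of_nonneg h0 (by linarith) hθ.le]
    gcongr
    calc P.phi x ^ (p.σ - p.θ) ≤ M ^ (p.σ - p.θ) := Real.rpow_le_rpow h0 h (by linarith)
      _ ≤ M ^ (1 : ℝ) := Real.rpow_le_rpow_of_exponent_le hM (by linarith)
      _ = M := Real.rpow_one M

theorem beta_num_nonneg (P : Problem n m) {p : Params} (hp : p.Admissible) {x d₀ : E n}
    (hg : ⟪P.g₀ x, d₀⟫_ℝ ≤ 0) : 0 ≤ (p.θ - 1) * ⟪P.g₀ x, d₀⟫_ℝ + P.phi x ^ p.θ := by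
  have h0 := Real.rpow_nonneg (P.phi_nonneg x) p.θ
  have h1 := hp.θ_lt
  have h2 := hp.σ_lt
  have := mul_nonneg (by linarith : 0 ≤ 1 - p.θ) (neg_nonneg.2 hg)
  linarith

theorem beta_mem_Icc (P : Problem n m) {p : Params} (hp : p.Admissible) {x d₀ : E n}
    (hg : ⟪P.g₀ x, d₀⟫_ℝ ≤ 0) (dt : E n) : 0 ≤ P.beta p x d₀ dt ∧ P.beta p x d₀ dt ≤ 1 := by
  unfold beta
  split_ifs with h
  · exact ⟨le_min zero_le_one (div_nonneg (P.beta_num_nonneg hp hg) (sub_pos.2 h).le),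
      min_le_left _ _⟩
  · simp

/-- The fraction in `beta` is the weight at which the right-hand side is attained exactly; when `dt`
is no worse than `d₀` for the objective, nonnegativity of the numerator suffices. -/
theorem inner_g₀_q_le (P : Problem n m) {p : Params} (hp : p.Admissible) {x d₀ : E n}
    (hg : ⟪P.g₀ x, d₀⟫_ℝ ≤ 0) (dt : E n) :
    ⟪P.g₀ x, P.q p x d₀ dt⟫_ℝ ≤ p.θ * ⟪P.g₀ x, d₀⟫_ℝ + P.phi x ^ p.θ := by
  have hnum := P.beta_num_nonneg hp hg
  have e : ⟪P.g₀ x, P.q p x d₀ dt⟫_ℝ = ⟪P.g₀ x, d₀⟫_ℝ +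
      P.beta p x d₀ dt * (⟪P.g₀ x, dt⟫_ℝ - ⟪P.g₀ x, d₀⟫_ℝ) := by
    simp only [q, inner_add_right, inner_smul_right]
    ring
  rw [e]
  unfold beta
  split_ifs with h
  · have h1 := sub_pos.2 h
    have h2 := mul_le_mul_of_nonneg_right (min_le_right 1
      (((p.θ - 1) * ⟪P.g₀ x, d₀⟫_ℝ + P.phi x ^ p.θ) / (⟪P.g₀ x, dt⟫_ℝ - ⟪P.g₀ x, d₀⟫_ℝ))) h1.le
    rw [div_mul_cancel₀ _ h1.ne'] at h2
    linarith
  · linarith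

section

variable {p : Params} {a M : ℝ} {x : E n} {B : Matrix (Fin n) (Fin n) ℝ} {d₀ dt : E n}
  {lam ht : Fin m → ℝ}

theorem IterBounds.inner_nonpos (hb : P.IterBounds a M x B d₀ lam) (ha : 0 < a) :
    ⟪P.g₀ x, d₀⟫_ℝ ≤ 0 :=
  hb.descent.trans (neg_nonpos.2 (by positivity))

theorem IterBounds.tilde_le (hb : P.IterBounds a M x B d₀ lam)
    (hs : P.SolvesSLE x B d₀ (P.rhsTilde p x d₀) dt ht) :
    ‖dt‖ ≤ M * (‖d₀‖ + P.phi x ^ p.σ) ∧ ‖ht‖ ≤ M * (‖d₀‖ + P.phi x ^ p.σ) := by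
  have h0 : 0 ≤ ‖d₀‖ + P.phi x ^ p.σ :=
    add_nonneg (norm_nonneg _) (Real.rpow_nonneg (P.phi_nonneg x) _)
  refine hb.sle _ _ _ _ h0 (fun j => ?_) hs
  rw [rhsTilde, abs_neg, abs_of_nonneg h0]

/-- Lower bounds on the weight `β`. -/
theorem IterBounds.beta_lower (hp : p.Admissible) (ha : 0 < a) (hM : 1 ≤ M)
    (hb : P.IterBounds a M x B d₀ lam)
    (hs : P.SolvesSLE x B d₀ (P.rhsTilde p x d₀) dt ht) {c : ℝ} (hc : 0 < c)
    (hc1 : c * (2 * M ^ 2) ≤ (1 - p.θ) * a) (hc2 : c * (2 * M ^ 4) ≤ 1) :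
    c * ‖d₀‖ ≤ P.beta p x d₀ dt ∧
      c * P.phi x ^ p.σ ≤ P.beta p x d₀ dt * (‖d₀‖ + P.phi x ^ p.σ) := by
  obtain ⟨hs0, hsM, hsθ⟩ := P.rpow_bounds hp hM hb.phi_le
  obtain ⟨hdt, -⟩ := hb.tilde_le hs
  have hd₀ := hb.d₀_le
  have hdesc := hb.descent
  have hnum := P.beta_num_nonneg hp (hb.inner_nonpos ha)
  have hσ1 := hp.σ_lt
  have hθσ := hp.θ_lt
  have he0 := norm_nonneg d₀
  set s := P.phi x ^ p.σ
  set e := ‖d₀‖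
  set T := P.phi x ^ p.θ
  have hM2 : 1 ≤ M ^ 2 := one_le_pow₀ hM
  have hM3 : 1 ≤ M ^ 3 := one_le_pow₀ hM
  have hcM : c * M ≤ 1 := by
    have : c * M ≤ c * (2 * M ^ 4) := by
      gcongr
      nlinarith
    linarith
  have hc1' : c ≤ 1 := by nlinarith
  unfold beta
  have one : c * e ≤ 1 ∧ c * s ≤ 1 * (e + s) := by
    constructor
    · exact (mul_le_mul_of_nonneg_left hd₀ hc.le).trans hcM
    · nlinarith
  split_ifs with h
  · have hden := sub_pos.2 h
    set N := (p.θ - 1) * ⟪P.g₀ x, d₀⟫_ℝ + T with hN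
    set D := ⟪P.g₀ x, dt⟫_ℝ - ⟪P.g₀ x, d₀⟫_ℝ with hD
    have hDle : D ≤ 2 * M ^ 2 * (e + s) := by
      have h1 : ⟪P.g₀ x, dt⟫_ℝ ≤ M * (M * (e + s)) :=
        (real_inner_le_norm _ _).trans (by gcongr; exact hb.g₀_le)
      have h2 : -⟪P.g₀ x, d₀⟫_ℝ ≤ M * e :=
        (neg_le_abs _).trans ((abs_real_inner_le_norm _ _).trans (by gcongr; exact hb.g₀_le))
      have h3 : M * e ≤ M ^ 2 * (e + s) := by
        calc M * e ≤ M ^ 2 * e := by gcongr; nlinarith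
          _ ≤ _ := by gcongr; linarith
      nlinarith
    have hW : 0 < e + s := by
      by_contra hW
      have : e + s = 0 := le_antisymm (not_lt.1 hW) (by positivity)
      rw [this] at hDle
      linarith
    have hNge : (1 - p.θ) * a * e ^ 2 + T ≤ N := by
      have := mul_le_mul_of_nonneg_left hdesc (by linarith : 0 ≤ 1 - p.θ)
      rw [hN]
      linarith
    -- The mixed term from `e * D` is absorbed by `T`, as `e ≤ M` and `s ≤ M * T`; the pure term in
    -- `e ^ 2` is absorbed by the descent part of the numerator through `hc1`.
    have hsT : c * (2 * M ^ 2) * (e * s) ≤ T := by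
      calc c * (2 * M ^ 2) * (e * s) ≤ c * (2 * M ^ 2) * (M * (M * T)) := by gcongr
        _ = (c * (2 * M ^ 4)) * T := by ring
        _ ≤ 1 * T := by
          gcongr
          exact Real.rpow_nonneg (P.phi_nonneg x) _
        _ = T := one_mul T
    have hsT2 : c * (2 * M ^ 2) * s ≤ T := by
      calc c * (2 * M ^ 2) * s ≤ c * (2 * M ^ 2) * (M ^ 2 * T) := by
            gcongr
            exact hsθ.trans (by
              gcongr
              · exact Real.rpow_nonneg (P.phi_nonneg x) _
              · nlinarith)
        _ = (c * (2 * M ^ 4)) * T := by ring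
        _ ≤ 1 * T := by
          gcongr
          exact Real.rpow_nonneg (P.phi_nonneg x) _
        _ = T := one_mul T
    have hae : 0 ≤ (1 - p.θ) * a * e ^ 2 :=
      mul_nonneg (mul_nonneg (by linarith) ha.le) (sq_nonneg _)
    have k1 : c * e ≤ N / D := by
      rw [le_div_iff₀ hden]
      calc c * e * D ≤ c * e * (2 * M ^ 2 * (e + s)) := by gcongr
        _ = c * (2 * M ^ 2) * e ^ 2 + c * (2 * M ^ 2) * (e * s) := by ring
        _ ≤ (1 - p.θ) * a * e ^ 2 + T := by gcongr
        _ ≤ N := hNge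
    have k2 : c * s ≤ N / D * (e + s) := by
      rw [div_mul_eq_mul_div, le_div_iff₀ hden]
      calc c * s * D ≤ c * s * (2 * M ^ 2 * (e + s)) := by gcongr
        _ = c * (2 * M ^ 2) * s * (e + s) := by ring
        _ ≤ N * (e + s) := by gcongr; linarith
    rcases min_choice 1 (N / D) with hm | hm <;> rw [hm]
    · exact one
    · exact ⟨k1, k2⟩
  · exact one

/-- The factor `β` is kept on `φ ^ σ` because the guaranteed decrease of the constraints is itself
only `β * (‖d₀‖ + φ ^ σ)`. -/
theorem IterBounds.norm_q_le (hp : p.Admissible) (ha : 0 < a) (hM : 1 ≤ M)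
    (hb : P.IterBounds a M x B d₀ lam)
    (hs : P.SolvesSLE x B d₀ (P.rhsTilde p x d₀) dt ht) :
    ‖P.q p x d₀ dt‖ ≤ 2 * M * (‖d₀‖ + P.beta p x d₀ dt * P.phi x ^ p.σ) := by
  obtain ⟨hdt, -⟩ := hb.tilde_le hs
  obtain ⟨h0, h1⟩ := P.beta_mem_Icc hp (hb.inner_nonpos ha) dt
  have hs0 := (P.rpow_bounds hp hM hb.phi_le).1
  have he0 := norm_nonneg d₀
  unfold q
  set β := P.beta p x d₀ dt
  set s := P.phi x ^ p.σ
  set e := ‖d₀‖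
  calc ‖(1 - β) • d₀ + β • dt‖ ≤ ‖(1 - β) • d₀‖ + ‖β • dt‖ := norm_add_le _ _
    _ = (1 - β) * e + β * ‖dt‖ := by
      rw [norm_smul, norm_smul, Real.norm_of_nonneg (by linarith), Real.norm_of_nonneg h0]
    _ ≤ (1 - β) * e + β * (M * (e + s)) := by gcongr
    _ ≤ 1 * e + (1 * (M * e) + M * (β * s)) := by
      have : β * (M * (e + s)) = β * (M * e) + M * (β * s) := by ring
      rw [this]
      gcongr
      linarith
    _ ≤ _ := by
      have : 0 ≤ M * (β * s) := by positivity
      nlinarith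

/-- The directional derivatives of the constraints along `q`. -/
theorem IterBounds.inner_g_q_le (hp : p.Admissible) (ha : 0 < a) (hM : 1 ≤ M)
    (hb : P.IterBounds a M x B d₀ lam) (hfeas : P.QPFeasible x d₀)
    (hs : P.SolvesSLE x B d₀ (P.rhsTilde p x d₀) dt ht) (j : Fin m) :
    ⟪P.g j x, P.q p x d₀ dt⟫_ℝ ≤
      (1 + 6 * M ^ 4) * |P.fbar j x| - P.beta p x d₀ dt * (‖d₀‖ + P.phi x ^ p.σ) := by
  obtain ⟨-, hht⟩ := hb.tilde_le hs
  obtain ⟨h0, h1⟩ := P.beta_mem_Icc hp (hb.inner_nonpos ha) dt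
  obtain ⟨hs0, hsM, -⟩ := P.rpow_bounds hp hM hb.phi_le
  have he0 := norm_nonneg d₀
  have heM := hb.d₀_le
  have hq : ⟪P.g j x, P.q p x d₀ dt⟫_ℝ = (1 - P.beta p x d₀ dt) * ⟪P.g j x, d₀⟫_ℝ +
      P.beta p x d₀ dt * ⟪P.g j x, dt⟫_ℝ := by
    simp only [q, inner_add_right, inner_smul_right]
  rw [hq]
  have hj1 : ⟪P.g j x, d₀⟫_ℝ ≤ |P.fbar j x| := by
    rw [abs_fbar]; linarith [hfeas j]
  have hj2 : ⟪P.g j x, dt⟫_ℝ = P.diag x d₀ j * ht j - (‖d₀‖ + P.phi x ^ p.σ) := by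
    have := hs.2 j
    rw [rhsTilde] at this
    linarith
  have hj3 : P.diag x d₀ j * ht j ≤ 6 * M ^ 4 * |P.fbar j x| := by
    have hD : P.diag x d₀ j ≤ |P.fbar j x| * (3 * M ^ 2) := by
      unfold diag
      gcongr
      have k1 : |P.fbar j x + ⟪P.g j x, d₀⟫_ℝ| ≤ M + M * M :=
        (abs_add_le _ _).trans (add_le_add (hb.fbar_le j)
          ((abs_real_inner_le_norm _ _).trans (by gcongr; exact hb.g_le j)))
      nlinarith
    have hh : ht j ≤ 2 * M ^ 2 := by
      calc ht j ≤ |ht j| := le_abs_self _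
        _ ≤ ‖ht‖ := norm_le_pi_norm ht j
        _ ≤ M * (‖d₀‖ + P.phi x ^ p.σ) := hht
        _ ≤ M * (M + M) := by gcongr
        _ = _ := by ring
    calc P.diag x d₀ j * ht j ≤ P.diag x d₀ j * (2 * M ^ 2) := by
          gcongr; exact P.diag_nonneg _ _ _
      _ ≤ |P.fbar j x| * (3 * M ^ 2) * (2 * M ^ 2) := by gcongr
      _ = _ := by ring
  rw [hj2]
  set β := P.beta p x d₀ dt
  have k1 := mul_le_mul_of_nonneg_left hj1 (sub_nonneg.2 h1)
  have k2 := mul_le_mul_of_nonneg_left hj3 h0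
  have k3 : 0 ≤ |P.fbar j x| := abs_nonneg _
  have k4 : (1 - β) * |P.fbar j x| ≤ 1 * |P.fbar j x| := by gcongr; linarith
  have k5 : β * (6 * M ^ 4 * |P.fbar j x|) ≤ 1 * (6 * M ^ 4 * |P.fbar j x|) := by gcongr
  linarith

/-- The second line search accepts every step length below an explicit bound. -/
theorem IterBounds.acceptII (hp : p.Admissible) (ha : 0 < a) (hM : 1 ≤ M)
    (hb : P.IterBounds a M x B d₀ lam) (hfeas : P.QPFeasible x d₀)
    (hs : P.SolvesSLE x B d₀ (P.rhsTilde p x d₀) dt ht) {L : ℝ} (hL : 0 < L)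
    (hT₀ : TaylorBound P.f₀ L (4 * M ^ 2) x) (hT : ∀ j, TaylorBound (P.f j) L (4 * M ^ 2) x)
    {c : ℝ} (hc : 0 < c)
    (hc1 : c * (2 * M ^ 2) ≤ (1 - p.θ) * a) (hc2 : c * (2 * M ^ 4) ≤ 1)
    {t : ℝ} (ht0 : 0 < t) (ht1 : t ≤ 1) (ht2 : t * (1 + 6 * M ^ 4) ≤ 1)
    (ht3 : t * (L * (8 * M ^ 2 * (1 / c + M))) ≤ 1 - p.γ)
    (ht4 : t * (L * (8 * M ^ 4)) ≤ (1 - p.γ) * (p.θ * a))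
    (ht5 : t * (L * (8 * M ^ 4)) ≤ (1 - p.γ) * (p.ρ - 1)) :
    P.AcceptII p x d₀ dt t := by
  obtain ⟨hβ0, hβ1⟩ := P.beta_mem_Icc hp (hb.inner_nonpos ha) dt
  obtain ⟨hs0, hsM, hsθ⟩ := P.rpow_bounds hp hM hb.phi_le
  obtain ⟨hbl, -⟩ := hb.beta_lower hp ha hM hs hc hc1 hc2
  have hq := hb.norm_q_le hp ha hM hs
  have hgq := hb.inner_g_q_le hp ha hM hfeas hs
  have hg₀q := P.inner_g₀_q_le hp (hb.inner_nonpos ha) dt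
  have hdesc := hb.descent
  have hγ := hp.γ_mem
  have hθ := hp.θ_pos
  have hTθ := Real.rpow_nonneg (P.phi_nonneg x) p.θ
  have he0 := norm_nonneg d₀
  have heM := hb.d₀_le
  set β := P.beta p x d₀ dt with hβ
  set Q := P.q p x d₀ dt with hQ
  set s := P.phi x ^ p.σ with hsdef
  set T := P.phi x ^ p.θ with hTdef
  set e := ‖d₀‖ with hedef
  have hβs0 : 0 ≤ β * s := mul_nonneg hβ0 hs0
  have hβs : β * s ≤ s := mul_le_of_le_one_left hs0 hβ1
  have hM1 : 1 ≤ M ^ 2 := one_le_pow₀ hM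
  -- This is the origin of the radius `4 * M ^ 2` in the Taylor hypotheses.
  have hQr : ‖t • Q‖ ≤ 4 * M ^ 2 := by
    rw [norm_smul, Real.norm_of_nonneg ht0.le]
    calc t * ‖Q‖ ≤ 1 * (2 * M * (M + M)) := by
          gcongr
          refine hq.trans ?_
          gcongr
          linarith
      _ = _ := by ring
  have hQsq : ‖Q‖ ^ 2 ≤ 8 * M ^ 2 * (e ^ 2 + (β * s) ^ 2) := by
    calc ‖Q‖ ^ 2 ≤ (2 * M * (e + β * s)) ^ 2 := by gcongr
      _ = 4 * M ^ 2 * (e + β * s) ^ 2 := by ring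
      _ ≤ 4 * M ^ 2 * (2 * (e ^ 2 + (β * s) ^ 2)) := by gcongr; exact add_sq_le
      _ = _ := by ring
  -- The quadratic Taylor error is measured in two currencies: here against the linear decrease of
  -- the constraints, using `c * e ≤ β`; in `hQ2` against the decrease and slack of the objective.
  have hQ1 : ‖Q‖ ^ 2 ≤ 8 * M ^ 2 * (1 / c + M) * (β * (e + s)) := by
    have k1 : e ^ 2 ≤ 1 / c * (β * e) := by
      rw [one_div, ← div_eq_inv_mul, le_div_iff₀ hc]
      nlinarith
    have k2 : (β * s) ^ 2 ≤ M * (β * s) := by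
      rw [sq]; gcongr; linarith
    have k3 : 0 ≤ 1 / c * (β * s) := by positivity
    have k4 : 0 ≤ M * (β * e) := by positivity
    calc ‖Q‖ ^ 2 ≤ 8 * M ^ 2 * (e ^ 2 + (β * s) ^ 2) := hQsq
      _ ≤ 8 * M ^ 2 * ((1 / c + M) * (β * (e + s))) := by
        gcongr
        linarith
      _ = _ := by ring
  have hQ2 : ‖Q‖ ^ 2 ≤ 8 * M ^ 4 * (e ^ 2 + T) := by
    have k2 : (β * s) ^ 2 ≤ M ^ 2 * T := by
      calc (β * s) ^ 2 ≤ s ^ 2 := by gcongr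
        _ = s * s := sq s
        _ ≤ M * (M * T) := by gcongr
        _ = _ := by ring
    calc ‖Q‖ ^ 2 ≤ 8 * M ^ 2 * (e ^ 2 + (β * s) ^ 2) := hQsq
      _ ≤ 8 * M ^ 2 * (M ^ 2 * e ^ 2 + M ^ 2 * T) := by
        gcongr
        nlinarith [sq_nonneg e]
      _ = _ := by ring
  have taylor : ∀ {h : E n → ℝ}, TaylorBound h L (4 * M ^ 2) x →
      h (x + t • Q) ≤ h x + t * ⟪∇ h x, Q⟫_ℝ + t * (t * L * ‖Q‖ ^ 2) := by
    intro h hh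
    have := (hh 0 (t • Q) (by simp; positivity) hQr).1
    rw [add_zero, sub_zero, inner_smul_right, norm_smul, Real.norm_of_nonneg ht0.le] at this
    have := (abs_le.1 this).2
    have e : L * (t * ‖Q‖) ^ 2 = t * (t * L * ‖Q‖ ^ 2) := by ring
    linarith
  -- One inequality serves both constraint tests, since `f j + |fbar j|` equals `φ` for a violated
  -- constraint and `0` for a satisfied one.
  have hcon : ∀ j, P.f j (x + t • Q) ≤ P.f j x + |P.fbar j x| - p.γ * t * (β * (e + s)) := by
    intro j
    have h1 := taylor (hT j)
    have h2 : t * ⟪∇ (P.f j) x, Q⟫_ℝ ≤ t * ((1 + 6 * M ^ 4) * |P.fbar j x| - β * (e + s)) := by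
      gcongr; exact hgq j
    have h3 : t * (1 + 6 * M ^ 4) * |P.fbar j x| ≤ 1 * |P.fbar j x| := by gcongr
    have h4 : t * L * ‖Q‖ ^ 2 ≤ (1 - p.γ) * (β * (e + s)) := by
      calc t * L * ‖Q‖ ^ 2 ≤ t * L * (8 * M ^ 2 * (1 / c + M) * (β * (e + s))) := by gcongr
        _ = t * (L * (8 * M ^ 2 * (1 / c + M))) * (β * (e + s)) := by ring
        _ ≤ _ := by gcongr
    have h5 := mul_le_mul_of_nonneg_left h4 ht0.le
    linarith
  refine ⟨?_, fun j hj => ?_, fun j hj => ?_⟩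
  · have h1 := taylor hT₀
    have h2 : ⟪∇ P.f₀ x, Q⟫_ℝ ≤ -(p.θ * a * e ^ 2) + T := by
      refine hg₀q.trans ?_
      have := mul_le_mul_of_nonneg_left hdesc hθ.le
      linarith
    have h3 : t * L * ‖Q‖ ^ 2 ≤ (1 - p.γ) * (p.θ * a * e ^ 2 + (p.ρ - 1) * T) := by
      calc t * L * ‖Q‖ ^ 2 ≤ t * L * (8 * M ^ 4 * (e ^ 2 + T)) := by gcongr
        _ = t * (L * (8 * M ^ 4)) * e ^ 2 + t * (L * (8 * M ^ 4)) * T := by ring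
        _ ≤ (1 - p.γ) * (p.θ * a) * e ^ 2 + (1 - p.γ) * (p.ρ - 1) * T := by gcongr
        _ = _ := by ring
    have h4 := mul_le_mul_of_nonneg_left h2 (sub_nonneg.2 hγ.2.le)
    have h5 := mul_le_mul_of_nonneg_left (add_le_add h3 h4) ht0.le
    change P.f₀ (x + t • Q) ≤ P.f₀ x + p.γ * t * ⟪∇ P.f₀ x, Q⟫_ℝ + p.ρ * (1 - p.γ) * t * T
    linarith
  · have := hcon j
    rw [abs_fbar, fbar_of_pos hj] at this
    rw [mul_assoc _ β]
    linarith
  · have := hcon j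
    rw [abs_fbar, fbar_of_nonpos hj] at this
    have h2 : 0 ≤ p.γ * t * (β * (e + s)) :=
      mul_nonneg (mul_nonneg hγ.1.le ht0.le) (mul_nonneg hβ0 (by positivity))
    linarith

end

end

/-! ### Global phase: finite feasibility and vanishing directions. -/

section

variable {P : Problem n m} {p : Params} {x : ℕ → E n} {B : ℕ → Matrix (Fin n) (Fin n) ℝ}
  {d₀ : ℕ → E n} {lam : ℕ → Fin m → ℝ} {d₁ : ℕ → E n}

/-- The step lengths of the second line search are bounded away from zero. -/
theorem exists_step_lower_bound (hp : p.Admissible) (hrun : P.IsRun p x B d₀ lam d₁) {a M L : ℝ}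
    (ha : 0 < a) (hM : 1 ≤ M) (hb : ∀ k, P.IterBounds a M (x k) (B k) (d₀ k) (lam k))
    (hL : 0 < L) (hT : ∀ k, TaylorBound P.f₀ L (4 * M ^ 2) (x k) ∧
      ∀ j, TaylorBound (P.f j) L (4 * M ^ 2) (x k)) :
    ∃ c t : ℝ, 0 < c ∧ 0 < t ∧ ∀ (k : ℕ) (dt : E n) (ht : Fin m → ℝ),
      P.SolvesSLE (x k) (B k) (d₀ k) (P.rhsTilde p (x k) (d₀ k)) dt ht →
      c * P.phi (x k) ^ p.σ ≤
          P.beta p (x k) (d₀ k) dt * (‖d₀ k‖ + P.phi (x k) ^ p.σ) ∧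
      ∀ i : ℕ, (∀ l < i, ¬ P.AcceptII p (x k) (d₀ k) dt (p.η ^ l)) → t ≤ p.η ^ i := by
  obtain ⟨hγ0, hγ1⟩ := hp.γ_mem
  obtain ⟨hη0, hη1⟩ := hp.η_mem
  have hθ := hp.θ_pos
  have hθ1 : 0 < 1 - p.θ := by linarith [hp.θ_lt, hp.σ_lt]
  have hρ : 0 < p.ρ - 1 := by linarith [hp.ρ_gt]
  have hγ : 0 < 1 - p.γ := by linarith
  have hM0 : 0 < M := by linarith
  set c := min ((1 - p.θ) * a / (2 * M ^ 2)) (1 / (2 * M ^ 4)) with hcdef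
  have hc : 0 < c := by positivity
  have hc1 : c * (2 * M ^ 2) ≤ (1 - p.θ) * a :=
    (le_div_iff₀ (by positivity)).1 (min_le_left _ _)
  have hc2 : c * (2 * M ^ 4) ≤ 1 := (le_div_iff₀ (by positivity)).1 (min_le_right _ _)
  set t := min (min 1 (1 / (1 + 6 * M ^ 4))) (min ((1 - p.γ) / (L * (8 * M ^ 2 * (1 / c + M))))
    (min ((1 - p.γ) * (p.θ * a) / (L * (8 * M ^ 4)))
      ((1 - p.γ) * (p.ρ - 1) / (L * (8 * M ^ 4))))) with htdef
  have ht : 0 < t := by positivity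
  have h1 : t ≤ 1 := (min_le_left _ _).trans (min_le_left _ _)
  have h2 : t ≤ 1 / (1 + 6 * M ^ 4) := (min_le_left _ _).trans (min_le_right _ _)
  have h3 : t ≤ (1 - p.γ) / (L * (8 * M ^ 2 * (1 / c + M))) :=
    (min_le_right _ _).trans (min_le_left _ _)
  have h4 : t ≤ (1 - p.γ) * (p.θ * a) / (L * (8 * M ^ 4)) :=
    (min_le_right _ _).trans ((min_le_right _ _).trans (min_le_left _ _))
  have h5 : t ≤ (1 - p.γ) * (p.ρ - 1) / (L * (8 * M ^ 4)) :=
    (min_le_right _ _).trans ((min_le_right _ _).trans (min_le_right _ _))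
  -- The factor `η` accounts for backtracking: the trial length before the accepted one was
  -- rejected, hence larger than `t`.
  refine ⟨c, p.η * t, hc, by positivity, fun k dt h hs => ⟨?_, fun i hi => ?_⟩⟩
  · exact ((hb k).beta_lower hp ha hM hs hc hc1 hc2).2
  · cases i with
    | zero =>
      rw [pow_zero]
      nlinarith
    | succ i =>
      rw [pow_succ, mul_comm]
      refine mul_le_mul_of_nonneg_right ?_ hη0.le
      by_contra hlt
      have hle := (not_le.1 hlt).le
      refine hi i (Nat.lt_succ_self i) ((hb k).acceptII hp ha hM (hrun.qp k).1 hs hL (hT k).1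
        (hT k).2 hc hc1 hc2 (pow_pos hη0 i) (hle.trans h1) ?_ ?_ ?_ ?_)
      · exact (le_div_iff₀ (by positivity)).1 (hle.trans h2)
      · exact (le_div_iff₀ (by positivity)).1 (hle.trans h3)
      · exact (le_div_iff₀ (by positivity)).1 (hle.trans h4)
      · exact (le_div_iff₀ (by positivity)).1 (hle.trans h5)

/-- Progress made in one iteration: the violation decreases as long as it is positive, and the
objective decreases once it is zero. -/
theorem exists_progress (hp : p.Admissible) (hrun : P.IsRun p x B d₀ lam d₁) {a M L : ℝ}
    (ha : 0 < a) (hM : 1 ≤ M) (hb : ∀ k, P.IterBounds a M (x k) (B k) (d₀ k) (lam k))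
    (hL : 0 < L) (hT : ∀ k, TaylorBound P.f₀ L (4 * M ^ 2) (x k) ∧
      ∀ j, TaylorBound (P.f j) L (4 * M ^ 2) (x k)) :
    ∃ c : ℝ, 0 < c ∧ ∀ k,
      (0 < P.phi (x (k + 1)) → P.phi (x (k + 1)) ≤ P.phi (x k) - c * P.phi (x k) ^ p.σ) ∧
      (P.phi (x k) = 0 → P.phi (x (k + 1)) = 0 ∧
        P.f₀ (x (k + 1)) ≤ P.f₀ (x k) - c * ‖d₀ k‖ ^ 2) := by
  obtain ⟨c, t, hc, ht, hct⟩ := exists_step_lower_bound hp hrun ha hM hb hL hT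
  obtain ⟨hγ0, hγ1⟩ := hp.γ_mem
  obtain ⟨hη0, hη1⟩ := hp.η_mem
  obtain ⟨hε0, hε1⟩ := hp.ε_mem
  obtain ⟨hα0, -⟩ := hp.α_mem
  have hθ := hp.θ_pos
  set κ := min (min (p.α * p.ε) (p.γ * t * c)) (min (p.α * p.ε * a) (p.γ * t * (p.θ * a)))
  have hκ : 0 < κ := by positivity
  have κ1 : κ ≤ p.α * p.ε := (min_le_left _ _).trans (min_le_left _ _)
  have κ2 : κ ≤ p.γ * t * c := (min_le_left _ _).trans (min_le_right _ _)
  have κ3 : κ ≤ p.α * p.ε * a := (min_le_right _ _).trans (min_le_left _ _)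
  have κ4 : κ ≤ p.γ * t * (p.θ * a) := (min_le_right _ _).trans (min_le_right _ _)
  refine ⟨κ, hκ, fun k => ?_⟩
  have hs0 : 0 ≤ P.phi (x k) ^ p.σ := Real.rpow_nonneg (P.phi_nonneg _) _
  have hdesc := (hb k).descent
  have he : 0 ≤ ‖d₀ k‖ ^ 2 := sq_nonneg _
  have step : (∀ j, P.f j (x k) ≤ 0 → P.f j (x (k + 1)) ≤ 0) ∧
      (∀ j, 0 < P.f j (x k) → P.f j (x (k + 1)) ≤ P.phi (x k) - κ * P.phi (x k) ^ p.σ) ∧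
      (P.phi (x k) = 0 → P.f₀ (x (k + 1)) ≤ P.f₀ (x k) - κ * ‖d₀ k‖ ^ 2) := by
    rcases hrun.update k with ⟨-, i, hi, hacc, -, hx⟩ | ⟨-, dt, h, hs, i, hacc, hrej, hx⟩
    · rw [hx]
      refine ⟨hacc.satisfied, fun j hj => (hacc.violated j hj).trans ?_, fun h0 => ?_⟩
      · have h1 : 0 ≤ ‖d₀ k‖ ^ p.τ := Real.rpow_nonneg (norm_nonneg _) _
        have : κ * P.phi (x k) ^ p.σ ≤
            p.α * (1 / 2) ^ i * (‖d₀ k‖ ^ p.τ + P.phi (x k) ^ p.σ) := by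
          calc κ * P.phi (x k) ^ p.σ ≤ p.α * p.ε * P.phi (x k) ^ p.σ := by gcongr
            _ ≤ p.α * (1 / 2) ^ i * (‖d₀ k‖ ^ p.τ + P.phi (x k) ^ p.σ) := by
              gcongr
              linarith
        linarith
      · have h1 := hacc.objective
        rw [h0, Real.zero_rpow hθ.ne', mul_zero, add_zero] at h1
        refine h1.trans ?_
        have h2 : p.α * (1 / 2) ^ i * ⟪P.g₀ (x k), d₀ k⟫_ℝ ≤
            p.α * (1 / 2) ^ i * -(a * ‖d₀ k‖ ^ 2) := by gcongr
        have h3 : κ * ‖d₀ k‖ ^ 2 ≤ p.α * (1 / 2) ^ i * (a * ‖d₀ k‖ ^ 2) := by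
          calc κ * ‖d₀ k‖ ^ 2 ≤ p.α * p.ε * a * ‖d₀ k‖ ^ 2 := by gcongr
            _ = p.α * p.ε * (a * ‖d₀ k‖ ^ 2) := by ring
            _ ≤ _ := by gcongr
        linarith
    · obtain ⟨hβ, hstep⟩ := hct k dt h hs
      have hti := hstep i hrej
      rw [hx]
      refine ⟨hacc.satisfied, fun j hj => (hacc.violated j hj).trans ?_, fun h0 => ?_⟩
      · have : κ * P.phi (x k) ^ p.σ ≤ p.γ * p.η ^ i * P.beta p (x k) (d₀ k) dt *
            (‖d₀ k‖ + P.phi (x k) ^ p.σ) := by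
          calc κ * P.phi (x k) ^ p.σ ≤ p.γ * t * c * P.phi (x k) ^ p.σ := by gcongr
            _ = p.γ * t * (c * P.phi (x k) ^ p.σ) := by ring
            _ ≤ p.γ * p.η ^ i * (P.beta p (x k) (d₀ k) dt * (‖d₀ k‖ + P.phi (x k) ^ p.σ)) := by
              gcongr
            _ = _ := by ring
        linarith
      · have h1 := hacc.objective
        have h2 := P.inner_g₀_q_le hp ((hb k).inner_nonpos ha) dt
        rw [h0, Real.zero_rpow hθ.ne', mul_zero, add_zero] at h1
        rw [h0, Real.zero_rpow hθ.ne', add_zero] at h2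
        refine h1.trans ?_
        have h4 : p.γ * p.η ^ i * ⟪P.g₀ (x k), P.q p (x k) (d₀ k) dt⟫_ℝ ≤
            p.γ * p.η ^ i * (p.θ * -(a * ‖d₀ k‖ ^ 2)) := by
          gcongr
          exact h2.trans (by gcongr)
        have h3 : κ * ‖d₀ k‖ ^ 2 ≤ p.γ * p.η ^ i * (p.θ * (a * ‖d₀ k‖ ^ 2)) := by
          calc κ * ‖d₀ k‖ ^ 2 ≤ p.γ * t * (p.θ * a) * ‖d₀ k‖ ^ 2 := by gcongr
            _ = p.γ * t * (p.θ * (a * ‖d₀ k‖ ^ 2)) := by ring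
            _ ≤ _ := by gcongr
        linarith
  obtain ⟨s1, s2, s3⟩ := step
  refine ⟨fun hpos => ?_, fun h0 => ⟨?_, s3 h0⟩⟩
  -- Satisfied constraints stay satisfied, so a constraint attaining a positive new violation was
  -- violated before and obeys the decrease test.
  · obtain ⟨j, hj⟩ := exists_phi_le_of_pos hpos
    rcases le_or_gt (P.f j (x k)) 0 with hle | hlt
    · linarith [s1 j hle]
    · exact hj.trans (s2 j hlt)
  · exact phi_eq_zero_iff.2 fun j => s1 j (phi_eq_zero_iff.1 h0 j)

/-- A sequence of positive numbers cannot satisfy `u (k + 1) ≤ u k - c * u k ^ σ` with `σ < 1`. -/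
theorem not_forall_pos_of_sub_rpow {u : ℕ → ℝ} {c σ : ℝ} (hc : 0 < c) (hσ0 : 0 < σ) (hσ : σ < 1)
    (h : ∀ k, u (k + 1) ≤ u k - c * u k ^ σ) : ¬ ∀ k, 0 < u k := by
  intro hpos
  set v := c ^ (1 - σ)⁻¹
  have hv : 0 < v := Real.rpow_pos_of_pos hc _
  -- Positivity of the next term forces `c * u k ^ σ < u k`, that is `u k ^ (1 - σ) > c`. With this
  -- lower bound the decrements stay above a positive constant.
  have hlow : ∀ k, v ≤ u k := fun k => by
    have h1 := h k
    have h2 := hpos (k + 1)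
    have h3 : u k ^ σ * u k ^ (1 - σ) = u k := by
      rw [← Real.rpow_add (hpos k), add_sub_cancel, Real.rpow_one]
    have h4 : 0 < u k ^ σ := Real.rpow_pos_of_pos (hpos k) _
    refine ((Real.rpow_inv_lt_iff_of_pos hc.le (hpos k).le (by linarith)).2 ?_).le
    nlinarith
  have hdec : ∀ k : ℕ, u k ≤ u 0 - k * (c * v ^ σ) := by
    intro k
    induction k with
    | zero => simp
    | succ k ih =>
      have : c * v ^ σ ≤ c * u k ^ σ := by gcongr; exact hlow k
      push_cast
      linarith [h k]
  have hcv : 0 < c * v ^ σ := by positivity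
  obtain ⟨k, hk⟩ := exists_nat_gt (u 0 / (c * v ^ σ))
  rw [div_lt_iff₀ hcv] at hk
  linarith [hdec k, hpos k]

/-- The iterates are feasible after finitely many steps, and the directions `d₀` tend to zero. -/
theorem eventually_feasible_and_tendsto (hp : p.Admissible) (hrun : P.IsRun p x B d₀ lam d₁)
    {a M L : ℝ} (ha : 0 < a) (hM : 1 ≤ M)
    (hb : ∀ k, P.IterBounds a M (x k) (B k) (d₀ k) (lam k))
    (hL : 0 < L) (hT : ∀ k, TaylorBound P.f₀ L (4 * M ^ 2) (x k) ∧
      ∀ j, TaylorBound (P.f j) L (4 * M ^ 2) (x k))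
    (hf₀ : Continuous P.f₀) (hbdd : Bornology.IsBounded (Set.range x)) :
    (∀ᶠ k in atTop, P.phi (x k) = 0) ∧ Tendsto d₀ atTop (𝓝 0) := by
  obtain ⟨c, hc, hprog⟩ := exists_progress hp hrun ha hM hb hL hT
  have hfeas : ∃ k₀, P.phi (x k₀) = 0 := by
    by_contra! hne
    have hpos : ∀ k, 0 < P.phi (x k) := fun k => (P.phi_nonneg _).lt_of_ne' (hne k)
    exact not_forall_pos_of_sub_rpow hc (hp.θ_pos.trans hp.θ_lt) hp.σ_lt
      (u := fun k => P.phi (x k)) (fun k => (hprog k).1 (hpos _)) hpos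
  obtain ⟨k₀, hk₀⟩ := hfeas
  have hzero : ∀ i, P.phi (x (i + k₀)) = 0 := by
    intro i
    induction i with
    | zero => rwa [zero_add]
    | succ i ih => rw [add_right_comm]; exact ((hprog _).2 ih).1
  refine ⟨eventually_atTop.2 ⟨k₀, fun k hk => by
    have := hzero (k - k₀); rwa [Nat.sub_add_cancel hk] at this⟩, ?_⟩
  have hdec : ∀ i, P.f₀ (x (i + 1 + k₀)) ≤ P.f₀ (x (i + k₀)) - c * ‖d₀ (i + k₀)‖ ^ 2 := fun i => by
    rw [add_right_comm]; exact ((hprog _).2 (hzero i)).2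
  have hanti : Antitone fun i => P.f₀ (x (i + k₀)) := antitone_nat_of_succ_le fun i => by
    have : 0 ≤ c * ‖d₀ (i + k₀)‖ ^ 2 := by positivity
    linarith [hdec i]
  have hbb : BddBelow (Set.range fun i => P.f₀ (x (i + k₀))) := by
    obtain ⟨C, hC⟩ := hbdd.isCompact_closure.exists_bound_of_continuousOn hf₀.continuousOn
    refine ⟨-C, ?_⟩
    rintro _ ⟨i, rfl⟩
    exact (abs_le.1 (hC _ (subset_closure ⟨_, rfl⟩))).1
  have hlim := tendsto_atTop_ciInf hanti hbb
  have hdiff := (hlim.sub (hlim.comp (tendsto_add_atTop_nat 1))).div_const c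
  rw [sub_self, zero_div] at hdiff
  have hsq : Tendsto (fun i => ‖d₀ (i + k₀)‖ ^ 2) atTop (𝓝 0) := by
    refine squeeze_zero (fun i => sq_nonneg _) (fun i => ?_) hdiff
    rw [le_div_iff₀ hc]
    have := hdec i
    simp only [Function.comp]
    linarith
  have hnorm : Tendsto (fun i => ‖d₀ (i + k₀)‖) atTop (𝓝 0) := by
    have := hsq.sqrt
    simpa using this
  exact (tendsto_add_atTop_iff_nat k₀).1 (tendsto_zero_iff_norm_tendsto_zero.2 hnorm)

end

/-! ### Limits near the accumulation point: KKT conditions and multipliers. -/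

section

variable {P : Problem n m} {p : Params} {x : ℕ → E n} {B : ℕ → Matrix (Fin n) (Fin n) ℝ}
  {d₀ : ℕ → E n} {lam : ℕ → Fin m → ℝ} {d₁ : ℕ → E n}

theorem contDiff_lagrangian (hf₀ : ContDiff ℝ 2 P.f₀) (hf : ∀ j, ContDiff ℝ 2 (P.f j))
    (mu : Fin m → ℝ) : ContDiff ℝ 2 (P.lagrangian mu) :=
  hf₀.add (ContDiff.sum fun j _ => contDiff_const.mul (hf j))

theorem gradient_lagrangian (hf₀ : ContDiff ℝ 2 P.f₀) (hf : ∀ j, ContDiff ℝ 2 (P.f j))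
    (mu : Fin m → ℝ) (z : E n) :
    ∇ (P.lagrangian mu) z = P.g₀ z + ∑ j, mu j • P.g j z := by
  refine HasGradientAt.gradient ?_
  rw [hasGradientAt_iff_hasFDerivAt]
  have h := (hasFDerivAt_of_contDiff hf₀ z).add
    (HasFDerivAt.fun_sum (u := Finset.univ) fun j _ =>
      (hasFDerivAt_of_contDiff (hf j) z).const_mul (mu j))
  refine h.congr_fderiv ?_
  ext v
  simp [g₀, g]

/-- A run of the algorithm with uniform bounds, feasible from some index on and with `d₀ → 0`,
together with a filter along which the iterates tend to `xstar`. -/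
structure RunNear (P : Problem n m) (p : Params) (x : ℕ → E n)
    (B : ℕ → Matrix (Fin n) (Fin n) ℝ) (d₀ : ℕ → E n) (lam : ℕ → Fin m → ℝ) (d₁ : ℕ → E n)
    (a M L : ℝ) (l : Filter ℕ) (xstar : E n) : Prop where
  contDiff₀ : ContDiff ℝ 2 P.f₀
  contDiff : ∀ j, ContDiff ℝ 2 (P.f j)
  admissible : p.Admissible
  run : P.IsRun p x B d₀ lam d₁
  a_pos : 0 < a
  one_le : 1 ≤ M
  bounds : ∀ k, P.IterBounds a M (x k) (B k) (d₀ k) (lam k)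
  L_pos : 0 < L
  taylor : ∀ k, TaylorBound P.f₀ L (4 * M ^ 2) (x k) ∧
    ∀ j, TaylorBound (P.f j) L (4 * M ^ 2) (x k)
  feasible : ∀ᶠ k in atTop, P.phi (x k) = 0
  d₀_tendsto : Tendsto d₀ atTop (𝓝 0)
  le_atTop : l ≤ atTop
  tendsto : Tendsto x l (𝓝 xstar)

variable {a M L : ℝ} {l : Filter ℕ} {xstar : E n}

theorem fbar_eq_of_phi_eq_zero {y : E n} (h : P.phi y = 0) (j : Fin m) : P.fbar j y = P.f j y :=
  fbar_of_nonpos (phi_eq_zero_iff.1 h j)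

theorem RunNear.mono {l' : Filter ℕ} (h : P.RunNear p x B d₀ lam d₁ a M L l xstar) (hl : l' ≤ l) :
    P.RunNear p x B d₀ lam d₁ a M L l' xstar :=
  { h with le_atTop := hl.trans h.le_atTop, tendsto := h.tendsto.mono_left hl }

section

variable (h : P.RunNear p x B d₀ lam d₁ a M L l xstar)
include h

theorem RunNear.tendsto_d₀ : Tendsto d₀ l (𝓝 0) := h.d₀_tendsto.mono_left h.le_atTop

theorem RunNear.tendsto_f (j : Fin m) : Tendsto (fun k => P.f j (x k)) l (𝓝 (P.f j xstar)) :=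
  ((h.contDiff j).continuous.tendsto _).comp h.tendsto

theorem RunNear.tendsto_g₀ : Tendsto (fun k => P.g₀ (x k)) l (𝓝 (P.g₀ xstar)) :=
  ((contDiff_gradient h.contDiff₀).continuous.tendsto _).comp h.tendsto

theorem RunNear.tendsto_g (j : Fin m) : Tendsto (fun k => P.g j (x k)) l (𝓝 (P.g j xstar)) :=
  ((contDiff_gradient (h.contDiff j)).continuous.tendsto _).comp h.tendsto

theorem RunNear.tendsto_fbar (j : Fin m) :
    Tendsto (fun k => P.fbar j (x k)) l (𝓝 (P.f j xstar)) := by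
  refine (h.tendsto_f j).congr' ?_
  filter_upwards [h.le_atTop h.feasible] with k hk
  exact (fbar_eq_of_phi_eq_zero hk j).symm

theorem RunNear.tendsto_act : Tendsto (fun k => act (B k) (d₀ k)) l (𝓝 0) := by
  refine squeeze_zero_norm (fun k => (h.bounds k).act_le (d₀ k)) ?_
  simpa using h.tendsto_d₀.norm.const_mul M

theorem RunNear.tendsto_inner (j : Fin m) :
    Tendsto (fun k => ⟪P.g j (x k), d₀ k⟫_ℝ) l (𝓝 0) := by
  simpa using (h.tendsto_g j).inner h.tendsto_d₀

theorem RunNear.eventually_f_nonpos : ∀ᶠ k in l, ∀ j, P.f j (x k) ≤ 0 := by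
  filter_upwards [h.le_atTop h.feasible] with k hk
  exact phi_eq_zero_iff.1 hk

/-- The multipliers lie in a compact ball, so they converge along an ultrafilter finer than `l`; the
subproblem conditions pass to the limit because `d₀ → 0`. -/
theorem RunNear.exists_isKKTPair [l.NeBot] : ∃ mu, P.IsKKTPair xstar mu := by
  obtain ⟨mu, -, hmu⟩ := (isCompact_closedBall (0 : Fin m → ℝ) M).ultrafilter_le_nhds'
    ((Ultrafilter.of l).map lam)
    (Ultrafilter.mem_map.2 (univ_mem' fun k => by simpa using (h.bounds k).lam_le))
  have h' := h.mono (Ultrafilter.of_le l)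
  have hlam : Tendsto lam (Ultrafilter.of l) (𝓝 mu) := hmu
  have hlamj : ∀ j, Tendsto (fun k => lam k j) (Ultrafilter.of l) (𝓝 (mu j)) :=
    tendsto_pi_nhds.1 hlam
  refine ⟨mu, ⟨?_, fun j => ?_, fun j => ?_, fun j => ?_⟩⟩
  · have h1 := (h'.tendsto_g₀.add h'.tendsto_act).add
      (tendsto_finsetSum Finset.univ fun j _ => (hlamj j).smul (h'.tendsto_g j))
    rw [add_zero] at h1
    refine tendsto_nhds_unique h1 (tendsto_const_nhds.congr fun k => ?_)
    exact (h.run.multiplier k).stationary.symm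
  · exact le_of_tendsto (h'.tendsto_f j) (h'.eventually_f_nonpos.mono fun k hk => hk j)
  · exact ge_of_tendsto' (hlamj j) fun k => (h.run.multiplier k).nonneg j
  · have h1 := (hlamj j).mul ((h'.tendsto_fbar j).add (h'.tendsto_inner j))
    rw [add_zero] at h1
    refine tendsto_nhds_unique h1 (tendsto_const_nhds.congr fun k => ?_)
    exact ((h.run.multiplier k).complementary j).symm

/-- The independence estimate is applied to `lam k - mu`. Its gradient combination vanishes in the
limit by the two stationarity conditions, its weighted part by the two complementarity conditions;
no subsequence of multipliers is needed. -/
theorem RunNear.tendsto_lam {mu : Fin m → ℝ} (hmu : P.IsKKTPair xstar mu) :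
    Tendsto (fun k => lam k - mu) l (𝓝 0) := by
  refine squeeze_zero_norm (fun k => (h.bounds k).independent (lam k - mu)) ?_
  rw [← mul_zero M, ← add_zero (0 : ℝ)]
  refine Tendsto.const_mul M (Tendsto.add ?_ ?_)
  · have h1 := (h.tendsto_g₀.add h.tendsto_act).add
      (tendsto_finsetSum Finset.univ fun j _ => (h.tendsto_g j).const_smul (mu j))
    rw [add_zero, hmu.stationary] at h1
    have h2 := h1.neg.norm
    rw [neg_zero, norm_zero] at h2
    refine h2.congr fun k => ?_
    congr 1
    have h3 := (h.run.multiplier k).stationary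
    simp only [Pi.sub_apply, sub_smul, Finset.sum_sub_distrib]
    rw [neg_add, ← eq_neg_of_add_eq_zero_right h3]
    abel
  · have h0 : (0 : ℝ) = ∑ _j : Fin m, (0 : ℝ) := by simp
    rw [h0]
    refine tendsto_finsetSum _ fun j _ => ?_
    have h1 : Tendsto (fun k => lam k j * ⟪P.g j (x k), d₀ k⟫_ℝ) l (𝓝 0) := by
      have h2 := (h.tendsto_inner j).norm.const_mul M
      rw [norm_zero, mul_zero] at h2
      refine squeeze_zero_norm (fun k => ?_) h2
      rw [norm_mul]
      gcongr
      exact (norm_le_pi_norm (lam k) j).trans (h.bounds k).lam_le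
    have h2 := (h.tendsto_fbar j).const_mul (mu j)
    rw [hmu.complementary j] at h2
    have h3 := (h1.add h2).abs
    rw [add_zero, abs_zero] at h3
    refine h3.congr fun k => ?_
    rw [← abs_mul, ← abs_neg]
    congr 1
    have := (h.run.multiplier k).complementary j
    simp only [Pi.sub_apply]
    linarith

theorem RunNear.tendsto_lam_apply {mu : Fin m → ℝ} (hmu : P.IsKKTPair xstar mu) (j : Fin m) :
    Tendsto (fun k => lam k j) l (𝓝 (mu j)) := by
  have := (tendsto_pi_nhds.1 (h.tendsto_lam hmu) j).add_const (mu j)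
  simpa using this

/-- The multipliers of constraints that are inactive at the limit vanish eventually. -/
theorem RunNear.eventually_lam_eq_zero {j : Fin m} (hj : P.f j xstar < 0) :
    ∀ᶠ k in l, lam k j = 0 := by
  have h1 := (h.tendsto_fbar j).add (h.tendsto_inner j)
  rw [add_zero] at h1
  filter_upwards [h1.eventually (gt_mem_nhds hj)] with k hk
  exact (mul_eq_zero.1 ((h.run.multiplier k).complementary j)).resolve_right hk.ne

/-- The constraint linearizations with positive limit multipliers are active eventually. -/
theorem RunNear.eventually_active {mu : Fin m → ℝ} (hmu : P.IsKKTPair xstar mu) {j : Fin m}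
    (hj : 0 < mu j) : ∀ᶠ k in l, P.fbar j (x k) + ⟪P.g j (x k), d₀ k⟫_ℝ = 0 := by
  filter_upwards [(h.tendsto_lam_apply hmu j).eventually (lt_mem_nhds hj)] with k hk
  exact (mul_eq_zero.1 ((h.run.multiplier k).complementary j)).resolve_left hk.ne'

theorem RunNear.eventually_close : ∀ᶠ k in l, ‖xstar - x k‖ ≤ 4 * M ^ 2 := by
  have h1 := (tendsto_const_nhds (x := xstar)).sub h.tendsto |>.norm
  rw [sub_self, norm_zero] at h1
  have hM := h.one_le
  exact h1.eventually_le_const (by positivity)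

/-- For an active constraint, the linearization at the iterate predicts the QP slack. -/
theorem RunNear.abs_inner_sub_le {j : Fin m} (hj : P.f j xstar = 0) :
    ∀ᶠ k in l, |⟪P.g j (x k), x k + d₀ k - xstar⟫_ℝ -
      (P.fbar j (x k) + ⟪P.g j (x k), d₀ k⟫_ℝ)| ≤ L * ‖x k - xstar‖ ^ 2 := by
  filter_upwards [h.eventually_close, h.le_atTop h.feasible] with k hk hφ
  have h0 : (0 : ℝ) ≤ 4 * M ^ 2 := by positivity
  have h1 := (((h.taylor k).2 j) 0 (xstar - x k) (by simpa using h0) hk).1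
  rw [add_zero, sub_zero, add_sub_cancel, hj, ← norm_neg (xstar - x k), neg_sub] at h1
  rw [fbar_eq_of_phi_eq_zero hφ]
  refine le_trans (le_of_eq ?_) h1
  congr 1
  have e1 : x k + d₀ k - xstar = -(xstar - x k) + d₀ k := by abel
  rw [e1, inner_add_right, inner_neg_right]
  simp only [g]
  ring

theorem RunNear.norm_g_sub_le (j : Fin m) :
    ∀ᶠ k in l, ‖P.g j xstar - P.g j (x k)‖ ≤ L * ‖x k - xstar‖ := by
  filter_upwards [h.eventually_close] with k hk
  have h0 : (0 : ℝ) ≤ 4 * M ^ 2 := by positivity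
  have h1 := (((h.taylor k).2 j) (xstar - x k) 0 hk (by simpa using h0)).2
  rw [add_sub_cancel, ← norm_neg (xstar - x k), neg_sub] at h1
  exact h1

end

end

/-! ### The full subproblem step is superlinear. -/

section

variable {P : Problem n m} {p : Params} {x : ℕ → E n} {B : ℕ → Matrix (Fin n) (Fin n) ℝ}
  {d₀ : ℕ → E n} {lam : ℕ → Fin m → ℝ} {d₁ : ℕ → E n}
  {a M L : ℝ} {l : Filter ℕ} {xstar : E n}

section

variable (h : P.RunNear p x B d₀ lam d₁ a M L l xstar)
include h

/-- The linearized optimality conditions at the limit hold up to a small error. -/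
theorem RunNear.residual_isLittleO {mu : Fin m → ℝ} (hmu : P.IsKKTPair xstar mu)
    (hhess : (fun k => hess (P.lagrangian mu) xstar (d₀ k) - act (B k) (d₀ k)) =o[atTop] d₀) :
    (fun k => hess (P.lagrangian mu) xstar (x k + d₀ k - xstar) +
      ∑ j, (lam k j - mu j) • P.g j (x k)) =o[l] (fun k => ‖x k - xstar‖ + ‖d₀ k‖) := by
  have h1 : (fun k => ∇ (P.lagrangian mu) (x k) - ∇ (P.lagrangian mu) xstar -
      hess (P.lagrangian mu) xstar (x k - xstar)) =o[l] (fun k => x k - xstar) :=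
    gradient_sub_isLittleO (contDiff_lagrangian h.contDiff₀ h.contDiff mu) tendsto_const_nhds
      h.tendsto
  have b1 : (fun k => x k - xstar) =O[l] (fun k => ‖x k - xstar‖ + ‖d₀ k‖) :=
    IsBigO.of_bound 1 (Eventually.of_forall fun k => by
      rw [one_mul, Real.norm_of_nonneg (by positivity)]
      linarith [norm_nonneg (d₀ k)])
  have b2 : d₀ =O[l] (fun k => ‖x k - xstar‖ + ‖d₀ k‖) :=
    IsBigO.of_bound 1 (Eventually.of_forall fun k => by
      rw [one_mul, Real.norm_of_nonneg (by positivity)]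
      linarith [norm_nonneg (x k - xstar)])
  have h2 := (hhess.mono h.le_atTop).trans_isBigO b2
  refine (h2.sub (h1.trans_isBigO b1)).congr_left fun k => ?_
  rw [gradient_lagrangian h.contDiff₀ h.contDiff, gradient_lagrangian h.contDiff₀ h.contDiff,
    hmu.stationary, sub_zero]
  have h3 := (h.run.multiplier k).stationary
  have e1 : x k + d₀ k - xstar = (x k - xstar) + d₀ k := by abel
  simp only [sub_smul, Finset.sum_sub_distrib]
  rw [eq_neg_of_add_eq_zero_right h3, e1, map_add]
  abel

/-- In the independence estimate the weighted part is eventually absorbed on the left: for active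
constraints `fbar j → 0`, and for inactive ones both multipliers vanish. The threshold `1 / (2 * M *
(m + 1))` makes the total at most half of `‖lam k - mu‖`. -/
theorem RunNear.norm_lam_sub_le {mu : Fin m → ℝ} (hmu : P.IsKKTPair xstar mu) :
    ∀ᶠ k in l, ‖lam k - mu‖ ≤ 2 * M * ‖∑ j, (lam k j - mu j) • P.g j (x k)‖ := by
  have hM : 0 < M := by linarith [h.one_le]
  have hj : ∀ j, ∀ᶠ k in l,
      |P.fbar j (x k)| * |(lam k - mu) j| ≤ 1 / (2 * M * (m + 1)) * ‖lam k - mu‖ := by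
    intro j
    rcases (hmu.feasible j).eq_or_lt with h0 | hneg
    · have h1 := (h.tendsto_fbar j).abs
      rw [h0, abs_zero] at h1
      filter_upwards [h1.eventually_le_const (by positivity : 0 < 1 / (2 * M * (m + 1)))] with k hk
      gcongr
      exact norm_le_pi_norm (lam k - mu) j
    · filter_upwards [h.eventually_lam_eq_zero hneg] with k hk
      have h2 : mu j = 0 := (mul_eq_zero.1 (hmu.complementary j)).resolve_right hneg.ne
      simp only [Pi.sub_apply, hk, h2, sub_zero, abs_zero, mul_zero]
      positivity
  filter_upwards [eventually_all.2 hj] with k hk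
  have h1 := (h.bounds k).independent (lam k - mu)
  have h2 : ∑ j, |P.fbar j (x k)| * |(lam k - mu) j| ≤ 1 / (2 * M) * ‖lam k - mu‖ := by
    calc _ ≤ ∑ _j : Fin m, 1 / (2 * M * (m + 1)) * ‖lam k - mu‖ :=
          Finset.sum_le_sum fun j _ => hk j
      _ = (m / (m + 1) : ℝ) * (1 / (2 * M) * ‖lam k - mu‖) := by
          simp; field_simp
      _ ≤ 1 * (1 / (2 * M) * ‖lam k - mu‖) := by
          gcongr
          rw [div_le_one (by positivity)]
          linarith
      _ = _ := one_mul _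
  have h3 : M * ∑ j, |P.fbar j (x k)| * |(lam k - mu) j| ≤ 1 / 2 * ‖lam k - mu‖ := by
    calc _ ≤ M * (1 / (2 * M) * ‖lam k - mu‖) := by gcongr
      _ = _ := by field_simp
  simp only [Pi.sub_apply] at h1 h3
  linarith

/-- This is the substitute for strict complementarity. With the subproblem slack `s ≤ 0` one has
`lam j * s = 0` and `mu j * s ≤ 0`, so `(lam j - mu j) * s ≥ 0`; replacing `s` by `⟪g j, w⟫` costs
only a quadratic error. -/
theorem RunNear.neg_mul_inner_le {mu : Fin m → ℝ} (hmu : P.IsKKTPair xstar mu) (j : Fin m) :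
    ∀ᶠ k in l, -((lam k j - mu j) * ⟪P.g j (x k), x k + d₀ k - xstar⟫_ℝ) ≤
      ‖lam k - mu‖ * (L * ‖x k - xstar‖ ^ 2) := by
  have hL := h.L_pos
  rcases (hmu.feasible j).eq_or_lt with h0 | hneg
  · filter_upwards [h.abs_inner_sub_le h0] with k hk
    set s := P.fbar j (x k) + ⟪P.g j (x k), d₀ k⟫_ℝ
    set w := ⟪P.g j (x k), x k + d₀ k - xstar⟫_ℝ
    have h1 : lam k j * s = 0 := (h.run.multiplier k).complementary j
    have h2 : s ≤ 0 := (h.run.qp k).1 j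
    have h3 : mu j * s ≤ 0 := mul_nonpos_of_nonneg_of_nonpos (hmu.nonneg j) h2
    have h4 : -((lam k j - mu j) * (w - s)) ≤ ‖lam k - mu‖ * (L * ‖x k - xstar‖ ^ 2) := by
      calc _ ≤ |(lam k j - mu j) * (w - s)| := neg_le_abs _
        _ = |(lam k - mu) j| * |w - s| := abs_mul _ _
        _ ≤ _ := by gcongr; exact norm_le_pi_norm (lam k - mu) j
    linarith
  · filter_upwards [h.eventually_lam_eq_zero hneg] with k hk
    have h2 : mu j = 0 := (mul_eq_zero.1 (hmu.complementary j)).resolve_right hneg.ne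
    rw [hk, h2]
    simp only [sub_zero, zero_mul, neg_zero]
    positivity

/-- A positive limit multiplier keeps `lam k j` positive, so the linearized constraint is tight and
`w` is nearly orthogonal to the limit gradient. This bounds the penalty term of the coercivity
estimate. -/
theorem RunNear.abs_inner_limit_le {mu : Fin m → ℝ} (hmu : P.IsKKTPair xstar mu) {j : Fin m}
    (hj : 0 < mu j) :
    ∀ᶠ k in l, |⟪P.g j xstar, x k + d₀ k - xstar⟫_ℝ| ≤
      L * ‖x k - xstar‖ * (‖x k - xstar‖ + ‖x k + d₀ k - xstar‖) := by
  have h0 : P.f j xstar = 0 := (mul_eq_zero.1 (hmu.complementary j)).resolve_left hj.ne'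
  filter_upwards [h.abs_inner_sub_le h0, h.eventually_active hmu hj, h.norm_g_sub_le j]
    with k h1 h2 h3
  rw [h2, sub_zero] at h1
  set w := x k + d₀ k - xstar
  have e : ⟪P.g j xstar, w⟫_ℝ = ⟪P.g j (x k), w⟫_ℝ + ⟪P.g j xstar - P.g j (x k), w⟫_ℝ := by
    rw [inner_sub_left]; ring
  rw [e]
  calc _ ≤ |⟪P.g j (x k), w⟫_ℝ| + |⟪P.g j xstar - P.g j (x k), w⟫_ℝ| := abs_add_le _ _
    _ ≤ L * ‖x k - xstar‖ ^ 2 + L * ‖x k - xstar‖ * ‖w‖ := by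
      gcongr
      exact (abs_real_inner_le_norm _ _).trans (by gcongr)
    _ = _ := by ring

/-- The full step of the quadratic subproblem is superlinearly close to the limit. -/
theorem RunNear.full_step_isLittleO {mu : Fin m → ℝ} (hmu : P.IsKKTPair xstar mu)
    (hsos : P.SSOSC xstar mu)
    (hhess : (fun k => hess (P.lagrangian mu) xstar (d₀ k) - act (B k) (d₀ k)) =o[atTop] d₀) :
    (fun k => x k + d₀ k - xstar) =o[l] (fun k => ‖x k - xstar‖ + ‖d₀ k‖) := by
  set H := hess (P.lagrangian mu) xstar with hH
  obtain ⟨c, C, hc, hC, hpen⟩ := exists_penalized_coercive H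
    (fun j => if 0 < mu j then P.g j xstar else 0) (fun d hd hv => hsos d hd fun j hj => by
      simpa [hj] using hv j)
  have hL := h.L_pos
  have hM : 0 < M := by linarith [h.one_le]
  have hres := h.residual_isLittleO hmu hhess
  rw [isLittleO_iff] at hres ⊢
  intro δ hδ
  -- The three summands collect the errors from the residual, from the multiplier sum, and from the
  -- penalty; `ε` is chosen so that `K * ε ≤ c * δ ^ 2`.
  set K := 1 + m * (2 * M * (1 + ‖H‖) * L) + 4 * C * m * L ^ 2 with hK
  have hK0 : 0 < K := by positivity
  set ε := min 1 (c * δ ^ 2 / K) with hε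
  have hε0 : 0 < ε := by positivity
  have hε1 : ε ≤ 1 := min_le_left _ _
  have hεK : K * ε ≤ c * δ ^ 2 := by
    rw [mul_comm]; exact (le_div_iff₀ hK0).1 (min_le_right _ _)
  have hclose : ∀ᶠ k in l, ‖x k - xstar‖ ≤ ε := by
    have h1 := (h.tendsto.sub_const xstar).norm
    rw [sub_self, norm_zero] at h1
    exact h1.eventually_le_const hε0
  have hcrit : ∀ᶠ k in l, ∀ j, 0 < mu j → |⟪P.g j xstar, x k + d₀ k - xstar⟫_ℝ| ≤
      L * ‖x k - xstar‖ * (‖x k - xstar‖ + ‖x k + d₀ k - xstar‖) := by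
    refine eventually_all.2 fun j => ?_
    by_cases hj : 0 < mu j
    · exact (h.abs_inner_limit_le hmu hj).mono fun k hk _ => hk
    · exact Eventually.of_forall fun k hj' => absurd hj' hj
  filter_upwards [hres hε0, hclose, hcrit, h.norm_lam_sub_le hmu,
    eventually_all.2 (h.neg_mul_inner_le hmu)] with k k1 k2 k3 k4 k5
  rw [Real.norm_of_nonneg (by positivity)] at k1 ⊢
  set w := x k + d₀ k - xstar with hw
  set u := x k - xstar with hu
  set N := ‖u‖ + ‖d₀ k‖ with hN
  set S := ∑ j, (lam k j - mu j) • P.g j (x k) with hS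
  have hN0 : 0 ≤ N := by positivity
  have huN : ‖u‖ ≤ N := by rw [hN]; linarith [norm_nonneg (d₀ k)]
  have hwN : ‖w‖ ≤ N := by
    have : w = u + d₀ k := by rw [hw, hu]; abel
    rw [this]; exact norm_add_le _ _
  have hSle : ‖S‖ ≤ (1 + ‖H‖) * N := by
    calc ‖S‖ = ‖(H w + S) - H w‖ := by rw [add_sub_cancel_left]
      _ ≤ ‖H w + S‖ + ‖H w‖ := norm_sub_le _ _
      _ ≤ ε * N + ‖H‖ * ‖w‖ := add_le_add k1 (H.le_opNorm w)
      _ ≤ 1 * N + ‖H‖ * N := by gcongr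
      _ = _ := by ring
  have hu2 : ‖u‖ ^ 2 ≤ ε * N := by
    rw [sq]; gcongr
  have hwS : -⟪w, S⟫_ℝ ≤ m * (2 * M * (1 + ‖H‖) * L) * ε * N ^ 2 := by
    calc -⟪w, S⟫_ℝ = ∑ j, -((lam k j - mu j) * ⟪P.g j (x k), w⟫_ℝ) := by
          rw [hS, inner_sum, ← Finset.sum_neg_distrib]
          refine Finset.sum_congr rfl fun j _ => ?_
          rw [inner_smul_right, real_inner_comm]
      _ ≤ ∑ _j : Fin m, ‖lam k - mu‖ * (L * ‖u‖ ^ 2) := Finset.sum_le_sum fun j _ => k5 j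
      _ = m * (‖lam k - mu‖ * (L * ‖u‖ ^ 2)) := by simp
      _ ≤ m * ((2 * M * ((1 + ‖H‖) * N)) * (L * (ε * N))) := by
          gcongr
          exact k4.trans (by gcongr)
      _ = _ := by ring
  have hwHS : ⟪w, H w + S⟫_ℝ ≤ ε * N ^ 2 := by
    calc _ ≤ ‖w‖ * ‖H w + S‖ := real_inner_le_norm _ _
      _ ≤ N * (ε * N) := by gcongr
      _ = _ := by ring
  have hsum : ∑ j, ⟪(if 0 < mu j then P.g j xstar else 0), w⟫_ℝ ^ 2 ≤
      m * (4 * L ^ 2 * ε * N ^ 2) := by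
    calc _ ≤ ∑ _j : Fin m, 4 * L ^ 2 * ε * N ^ 2 := by
          refine Finset.sum_le_sum fun j _ => ?_
          split_ifs with hj
          · rw [← sq_abs]
            calc _ ≤ (L * ‖u‖ * (‖u‖ + ‖w‖)) ^ 2 := by gcongr; exact k3 j hj
              _ ≤ (L * ε * (N + N)) ^ 2 := by gcongr
              _ = 4 * L ^ 2 * (ε * ε) * N ^ 2 := by ring
              _ ≤ 4 * L ^ 2 * (1 * ε) * N ^ 2 := by gcongr
              _ = _ := by ring
          · rw [inner_zero_left, zero_pow two_ne_zero]; positivity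
      _ = _ := by simp
  have hfin : c * ‖w‖ ^ 2 ≤ K * ε * N ^ 2 := by
    have h1 := hpen w
    have h2 := mul_le_mul_of_nonneg_left hsum hC
    rw [inner_add_right] at hwHS
    rw [hK]
    linarith
  have hfin2 : ‖w‖ ^ 2 ≤ (δ * N) ^ 2 := by
    refine le_of_mul_le_mul_left ?_ hc
    calc c * ‖w‖ ^ 2 ≤ K * ε * N ^ 2 := hfin
      _ ≤ c * δ ^ 2 * N ^ 2 := by gcongr
      _ = _ := by ring
  have hδN : 0 ≤ δ * N := by positivity
  exact le_of_sq_le_sq hfin2 hδN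

end

end

/-! ### Size of the steps and convergence of the whole sequence. -/

section

variable {P : Problem n m} {p : Params} {x : ℕ → E n} {B : ℕ → Matrix (Fin n) (Fin n) ℝ}
  {d₀ : ℕ → E n} {lam : ℕ → Fin m → ℝ} {d₁ : ℕ → E n}
  {a M L : ℝ} {l : Filter ℕ} {xstar : E n}

theorem eventually_norm_le_of_isLittleO {u d : ℕ → E n} {l : Filter ℕ}
    (h : (fun k => u k + d k) =o[l] (fun k => ‖u k‖ + ‖d k‖)) :
    ∀ᶠ k in l, ‖u k‖ ≤ 3 * ‖d k‖ ∧ ‖d k‖ ≤ 3 * ‖u k‖ := by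
  filter_upwards [(isLittleO_iff.1 h) (by norm_num : (0 : ℝ) < 1 / 2)] with k hk
  rw [Real.norm_of_nonneg (by positivity)] at hk
  have h1 : ‖u k‖ ≤ ‖u k + d k‖ + ‖d k‖ := by
    simpa using norm_sub_le (u k + d k) (d k)
  have h2 : ‖d k‖ ≤ ‖u k + d k‖ + ‖u k‖ := by
    simpa using norm_sub_le (u k + d k) (u k)
  constructor <;> linarith

theorem rpow_eq_sq_mul {e τ : ℝ} (he : 0 ≤ e) (hτ : 2 ≤ τ) : e ^ τ = e ^ 2 * e ^ (τ - 2) := by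
  rw [← Real.rpow_natCast, ← Real.rpow_add_of_nonneg he (by norm_num) (by linarith)]
  congr 1
  push_cast
  ring

section

variable (h : P.RunNear p x B d₀ lam d₁ a M L l xstar)
include h

theorem RunNear.eventually_norm_d₀_le {ε : ℝ} (hε : 0 < ε) : ∀ᶠ k in atTop, ‖d₀ k‖ ≤ ε := by
  have h1 := h.d₀_tendsto.norm
  rw [norm_zero] at h1
  exact h1.eventually_le_const hε

theorem RunNear.eventually_rpow_le {ε r : ℝ} (hr : 0 < r) (hε : 0 < ε) :
    ∀ᶠ k in atTop, ‖d₀ k‖ ^ r ≤ ε := by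
  have h1 := h.d₀_tendsto.norm.rpow_const (p := r) (Or.inr hr.le)
  rw [norm_zero, Real.zero_rpow hr.ne'] at h1
  exact h1.eventually_le_const hε

/-- The correction direction is of second order. -/
theorem RunNear.correction_le : ∀ᶠ k in atTop, ∃ h₁ : Fin m → ℝ,
    P.SolvesSLE (x k) (B k) (d₀ k) (P.rhsCorr p (x k) (d₀ k)) (d₁ k) h₁ ∧
      ‖d₁ k‖ ≤ M * (1 + L) * ‖d₀ k‖ ^ 2 ∧ ‖h₁‖ ≤ M * (1 + L) * ‖d₀ k‖ ^ 2 := by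
  have hσ : 0 < p.σ := h.admissible.θ_pos.trans h.admissible.θ_lt
  have hτ := h.admissible.τ_mem
  have hL := h.L_pos
  have hM := h.one_le
  filter_upwards [h.feasible, h.eventually_rpow_le (sub_pos.2 hτ.1) one_pos] with k hφ hτk
  obtain ⟨h₁, hs⟩ := h.run.correction k
  have hr : ∀ j, |P.rhsCorr p (x k) (d₀ k) j| ≤ (1 + L) * ‖d₀ k‖ ^ 2 := by
    intro j
    have hd : ‖d₀ k‖ ≤ 4 * M ^ 2 := (h.bounds k).d₀_le.trans (by nlinarith)
    have ht := (((h.taylor k).2 j) 0 (d₀ k) (by simp; positivity) hd).1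
    rw [add_zero, sub_zero] at ht
    unfold rhsCorr
    rw [hφ, Real.zero_rpow hσ.ne', add_zero, rpow_eq_sq_mul (norm_nonneg _) hτ.1.le]
    have h2 : ‖d₀ k‖ ^ 2 * ‖d₀ k‖ ^ (p.τ - 2) ≤ ‖d₀ k‖ ^ 2 * 1 := by gcongr
    have h3 : 0 ≤ ‖d₀ k‖ ^ 2 * ‖d₀ k‖ ^ (p.τ - 2) := by positivity
    obtain ⟨t1, t2⟩ := abs_le.1 ht
    change _ ≤ P.f j (x k + d₀ k) - P.f j (x k) - ⟪P.g j (x k), d₀ k⟫_ℝ at t1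
    change P.f j (x k + d₀ k) - P.f j (x k) - ⟪P.g j (x k), d₀ k⟫_ℝ ≤ _ at t2
    rw [abs_le]
    constructor <;> linarith
  obtain ⟨b1, b2⟩ := (h.bounds k).sle _ _ _ _ (by positivity) hr hs
  rw [← mul_assoc] at b1 b2
  exact ⟨h₁, hs, b1, b2⟩

/-- The steps are bounded by a multiple of the directions `d₀`. -/
theorem RunNear.exists_step_le :
    ∃ C : ℝ, 0 < C ∧ ∀ᶠ k in atTop, ‖x (k + 1) - x k‖ ≤ C * ‖d₀ k‖ := by
  have hσ : 0 < p.σ := h.admissible.θ_pos.trans h.admissible.θ_lt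
  have hη := h.admissible.η_mem
  have hL := h.L_pos
  have hM := h.one_le
  refine ⟨2 * M + (1 + M * (1 + L)), by positivity, ?_⟩
  filter_upwards [h.feasible, h.eventually_norm_d₀_le one_pos, h.correction_le]
    with k hφ hd ⟨_, _, hd₁, _⟩
  have hd0 := norm_nonneg (d₀ k)
  rcases h.run.update k with ⟨-, i, -, -, -, hx⟩ | ⟨-, dt, ht, hs, i, -, -, hx⟩
  · rw [hx, add_sub_cancel_left, norm_smul, Real.norm_of_nonneg (by positivity)]
    have h1 : ((1 : ℝ) / 2) ^ i ≤ 1 := pow_le_one₀ (by norm_num) (by norm_num)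
    calc (1 / 2) ^ i * ‖d₀ k + d₁ k‖ ≤ 1 * (‖d₀ k‖ + M * (1 + L) * (‖d₀ k‖ * 1)) := by
          gcongr
          refine (norm_add_le _ _).trans ?_
          gcongr
          refine hd₁.trans ?_
          rw [sq]
          gcongr
      _ = (1 + M * (1 + L)) * ‖d₀ k‖ := by ring
      _ ≤ _ := mul_le_mul_of_nonneg_right (by linarith) hd0
  · have hq := (h.bounds k).norm_q_le h.admissible h.a_pos hM hs
    rw [hφ, Real.zero_rpow hσ.ne', mul_zero, add_zero] at hq
    rw [hx, add_sub_cancel_left, norm_smul, Real.norm_of_nonneg (pow_nonneg hη.1.le i)]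
    have h1 : p.η ^ i ≤ 1 := pow_le_one₀ hη.1.le hη.2.le
    calc _ ≤ 1 * (2 * M * ‖d₀ k‖) := by gcongr
      _ = 2 * M * ‖d₀ k‖ := one_mul _
      _ ≤ _ := by
        gcongr
        have : 0 ≤ 1 + M * (1 + L) := by positivity
        linarith

/-- The whole sequence of iterates converges. -/
theorem RunNear.tendsto_atTop [l.NeBot] (hl : l = atTop ⊓ comap x (𝓝 xstar))
    (hw : (fun k => x k + d₀ k - xstar) =o[l] (fun k => ‖x k - xstar‖ + ‖d₀ k‖)) :
    Tendsto x atTop (𝓝 xstar) := by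
  have hev : ∀ᶠ k in l, ‖x k - xstar‖ ≤ 3 * ‖d₀ k‖ := by
    refine (eventually_norm_le_of_isLittleO (u := fun k => x k - xstar) (d := d₀) (l := l)
      (hw.congr_left fun k => ?_)).mono fun k hk => hk.1
    abel
  have hev' := hev
  -- Unpacking the filter shows that the bound by `3 * ‖d₀ k‖` holds at every late index whose
  -- iterate lies in a fixed ball, so it can drive an induction over consecutive indices.
  rw [hl, (atTop_basis.inf (Metric.nhds_basis_ball.comap x)).eventually_iff] at hev'
  obtain ⟨⟨K, r⟩, ⟨-, hr⟩, hKr⟩ := hev'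
  have hKr' : ∀ k, K ≤ k → ‖x k - xstar‖ < r → ‖x k - xstar‖ ≤ 3 * ‖d₀ k‖ := fun k hk hkr =>
    hKr ⟨hk, by simpa [dist_eq_norm] using hkr⟩
  obtain ⟨C, hC, hstep⟩ := h.exists_step_le
  obtain ⟨K', hK'⟩ := eventually_atTop.1 (hstep.and (h.eventually_norm_d₀_le
    (by simp only at hr; positivity : 0 < r / (2 * (3 + C)))))
  have hclose : ∀ᶠ k in l, ‖x k - xstar‖ < r := by
    have h1 := (h.tendsto.sub_const xstar).norm
    rw [sub_self, norm_zero] at h1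
    exact h1.eventually (gt_mem_nhds hr)
  obtain ⟨k₀, hk₀r, hk₀⟩ := (hclose.and
    (h.le_atTop (eventually_ge_atTop (max K K')))).exists
  -- Inside the ball, the next distance is at most `(C + 3) * ‖d₀ k‖ ≤ r / 2`, so the iterate stays
  -- inside.
  have hstay : ∀ k, k₀ ≤ k → ‖x k - xstar‖ < r := by
    intro k hk
    induction k, hk using Nat.le_induction with
    | base => exact hk₀r
    | succ k hk ih =>
      have hk1 : max K K' ≤ k := hk₀.trans hk
      have h1 := hKr' k ((le_max_left _ _).trans hk1) ih
      obtain ⟨h2, h3⟩ := hK' k ((le_max_right _ _).trans hk1)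
      rw [le_div_iff₀ (by positivity)] at h3
      calc ‖x (k + 1) - xstar‖ = ‖(x (k + 1) - x k) + (x k - xstar)‖ := by congr 1; abel
        _ ≤ ‖x (k + 1) - x k‖ + ‖x k - xstar‖ := norm_add_le _ _
        _ ≤ C * ‖d₀ k‖ + 3 * ‖d₀ k‖ := add_le_add h2 h1
        _ < r := by simp only at hr; linarith
  rw [tendsto_iff_norm_sub_tendsto_zero]
  have h1 := h.d₀_tendsto.norm.const_mul 3
  rw [norm_zero, mul_zero] at h1
  refine squeeze_zero' (Eventually.of_forall fun k => norm_nonneg _) ?_ h1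
  filter_upwards [eventually_ge_atTop k₀] with k hk
  exact hKr' k ((le_max_left _ _).trans (hk₀.trans hk)) (hstay k hk)

end

end

/-! ### Acceptance of the unit step and the superlinear rate. -/

section

variable {P : Problem n m} {p : Params} {x : ℕ → E n} {B : ℕ → Matrix (Fin n) (Fin n) ℝ}
  {d₀ : ℕ → E n} {lam : ℕ → Fin m → ℝ} {d₁ : ℕ → E n}
  {a M L : ℝ} {l : Filter ℕ} {xstar : E n}

/-- Expanding at `y + d` leaves `f (y + d)` exact; for the constraints this is the value that the
right-hand side of the correction system cancels. -/
theorem TaylorBound.add_le {f : E n → ℝ} {r : ℝ} {y d e : E n} (hT : TaylorBound f L r y)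
    (hd : ‖d‖ ≤ r) (hde : ‖d + e‖ ≤ r) :
    f (y + (d + e)) ≤ f (y + d) + ⟪∇ f y, e⟫_ℝ + L * ‖d‖ * ‖e‖ + L * ‖e‖ ^ 2 := by
  obtain ⟨h1, h2⟩ := hT d (d + e) hd hde
  rw [add_sub_cancel_left] at h1
  have h3 := (abs_le.1 h1).2
  have h4 : ⟪∇ f (y + d) - ∇ f y, e⟫_ℝ ≤ L * ‖d‖ * ‖e‖ :=
    (real_inner_le_norm _ _).trans (by gcongr)
  rw [inner_sub_left] at h4
  linarith

section

variable (h : P.RunNear p x B d₀ lam d₁ a M L l xstar)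
include h

theorem RunNear.exists_second_order_bounds : ∃ A : ℝ, 0 < A ∧ ∀ᶠ k in atTop,
    ‖d₀ k‖ ≤ 4 * M ^ 2 ∧ ‖d₀ k + d₁ k‖ ≤ 2 * ‖d₀ k‖ ∧ ‖d₀ k + d₁ k‖ ≤ 4 * M ^ 2 ∧
    ∃ h₁ : Fin m → ℝ,
      P.SolvesSLE (x k) (B k) (d₀ k) (P.rhsCorr p (x k) (d₀ k)) (d₁ k) h₁ ∧
      ‖d₁ k‖ ≤ A * ‖d₀ k‖ ^ 2 ∧ ‖h₁‖ ≤ A * ‖d₀ k‖ ^ 2 := by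
  have hL := h.L_pos
  have hM := h.one_le
  have hA : 0 < M * (1 + L) := by positivity
  refine ⟨M * (1 + L), hA, ?_⟩
  filter_upwards [h.correction_le, h.eventually_norm_d₀_le (one_div_pos.2 hA)]
    with k ⟨h₁, hs, hd, hh⟩ hk
  rw [le_div_iff₀ hA] at hk
  have h1 : ‖d₀ k + d₁ k‖ ≤ 2 * ‖d₀ k‖ := by
    have : M * (1 + L) * ‖d₀ k‖ ^ 2 ≤ 1 * ‖d₀ k‖ := by
      rw [sq, ← mul_assoc, mul_comm (M * (1 + L))]
      gcongr
    linarith [norm_add_le (d₀ k) (d₁ k)]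
  have h2 := (h.bounds k).d₀_le
  exact ⟨by nlinarith, h1, by nlinarith, h₁, hs, hd, hh⟩

/-- The direction test of the first cycle is eventually passed. -/
theorem RunNear.eventually_directionTest :
    ∀ᶠ k in atTop, P.DirectionTest p (x k) (d₀ k) (d₀ k + d₁ k) := by
  obtain ⟨A, hA, hev⟩ := h.exists_second_order_bounds
  have hδ := h.admissible.δ_gt
  have hζ := h.admissible.ζ_pos
  have ha := h.a_pos
  have h2 : 0 < (2 : ℝ) ^ p.δ := by positivity
  filter_upwards [h.feasible, hev,
    h.eventually_rpow_le (sub_pos.2 hδ) (by positivity : 0 < a / (p.ζ * 2 ^ p.δ))]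
    with k hφ ⟨_, hd, _, _⟩ hk
  rw [le_div_iff₀ (by positivity)] at hk
  unfold DirectionTest
  rw [hφ, Real.zero_rpow h.admissible.ϱ_pos.ne', mul_zero, add_zero]
  have hmono : ∀ {v : ℝ}, 0 ≤ v → v ≤ 2 * ‖d₀ k‖ → -(2 * ‖d₀ k‖) ^ p.δ ≤ -v ^ p.δ :=
    fun h0 hv => neg_le_neg (Real.rpow_le_rpow h0 hv (by linarith))
  -- Both powers are at most `(2 * ‖d₀‖) ^ δ`, which is `o(‖d₀‖²)` as `δ > 2` and so is beaten by
  -- the descent `-a * ‖d₀‖ ^ 2`.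
  have hmin : -(2 * ‖d₀ k‖) ^ p.δ ≤ min (-‖d₀ k‖ ^ p.δ) (-‖d₀ k + d₁ k‖ ^ p.δ) :=
    le_min (hmono (norm_nonneg _) (by linarith [norm_nonneg (d₀ k)])) (hmono (norm_nonneg _) hd)
  have h3 := mul_le_mul_of_nonneg_left hmin hζ.le
  have h4 : p.ζ * (2 * ‖d₀ k‖) ^ p.δ ≤ a * ‖d₀ k‖ ^ 2 := by
    rw [Real.mul_rpow (by norm_num) (norm_nonneg _), rpow_eq_sq_mul (norm_nonneg _) hδ.le]
    calc _ = ‖d₀ k‖ ^ (p.δ - 2) * (p.ζ * 2 ^ p.δ) * ‖d₀ k‖ ^ 2 := by ring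
      _ ≤ _ := by gcongr
  linarith [(h.bounds k).descent]

/-- The unit step along the corrected direction eventually preserves feasibility. -/
theorem RunNear.eventually_feasible_unit_step :
    ∀ᶠ k in atTop, ∀ j, P.f j (x k + (d₀ k + d₁ k)) ≤ 0 := by
  obtain ⟨A, hA, hev⟩ := h.exists_second_order_bounds
  have hτ := h.admissible.τ_mem
  have hσ : 0 < p.σ := h.admissible.θ_pos.trans h.admissible.θ_lt
  have hL := h.L_pos
  have hM := h.one_le
  set C := M * A + L * A + L * A ^ 2 with hC
  have hC0 : 0 < C := by positivity
  filter_upwards [h.feasible, hev, h.eventually_norm_d₀_le one_pos,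
    h.eventually_norm_d₀_le (by positivity : 0 < 1 / (M * A)),
    h.eventually_rpow_le (sub_pos.2 hτ.2) (one_div_pos.2 hC0)]
    with k hφ ⟨hd₀, _, hd, h₁, hs, hd₁, hh₁⟩ hk1 hkM hkτ j
  rw [le_div_iff₀ (by positivity)] at hkM hkτ
  have h1 := ((h.taylor k).2 j).add_le hd₀ hd
  have hsle := hs.2 j
  unfold rhsCorr at hsle
  rw [hφ, Real.zero_rpow hσ.ne', add_zero] at hsle
  change _ ≤ _ + ⟪P.g j (x k), d₁ k⟫_ℝ + _ + _ at h1
  have hfb : P.f j (x k) = P.fbar j (x k) := (fbar_eq_of_phi_eq_zero hφ j).symm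
  have hsj := (h.run.qp k).1 j
  set e := ‖d₀ k‖ with he
  have he0 : 0 ≤ e := norm_nonneg _
  set s := P.fbar j (x k) + ⟪P.g j (x k), d₀ k⟫_ℝ with hsdef
  have hhj : |h₁ j| ≤ A * e ^ 2 := (norm_le_pi_norm h₁ j).trans hh₁
  have hMh : M * (A * e ^ 2) ≤ 1 := by
    calc M * (A * e ^ 2) = e * (M * A) * e := by ring
      _ ≤ 1 * 1 := by gcongr
      _ = 1 := one_mul 1
  -- The correction system turns `f j (x + d₀) + ⟪g j, d₁⟫` into `s - e ^ τ + D j * h₁ j`. The part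
  -- of `D j * h₁ j` proportional to `-s` is absorbed by the slack, leaving a cubic error.
  have hD : P.diag (x k) (d₀ k) j * h₁ j ≤ -s + M * A * e ^ 3 := by
    unfold diag
    rw [← hsdef, ← he, abs_of_nonpos hsj]
    have hs0 : 0 ≤ -s + e := by linarith
    calc |P.fbar j (x k)| * (-s + e) * h₁ j ≤ |P.fbar j (x k)| * (-s + e) * |h₁ j| := by
          gcongr; exact le_abs_self _
      _ ≤ M * (-s + e) * (A * e ^ 2) := by
          gcongr; exact (h.bounds k).fbar_le j
      _ = -s * (M * (A * e ^ 2)) + M * A * e ^ 3 := by ring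
      _ ≤ -s * 1 + M * A * e ^ 3 := by gcongr; linarith
      _ = _ := by ring
  have h2 : L * e * ‖d₁ k‖ ≤ L * A * e ^ 3 := by
    calc L * e * ‖d₁ k‖ ≤ L * e * (A * e ^ 2) := by gcongr
      _ = _ := by ring
  have h3 : L * ‖d₁ k‖ ^ 2 ≤ L * A ^ 2 * e ^ 3 := by
    calc L * ‖d₁ k‖ ^ 2 ≤ L * (A * e ^ 2) ^ 2 := by gcongr
      _ = L * A ^ 2 * e ^ 3 * e := by ring
      _ ≤ L * A ^ 2 * e ^ 3 * 1 := by gcongr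
      _ = _ := mul_one _
  -- Here `τ < 3` matters: the shift `e ^ τ` outweighs all cubic errors.
  have h4 : C * e ^ 3 ≤ e ^ p.τ := by
    have e3 : e ^ 3 = e ^ p.τ * e ^ (3 - p.τ) := by
      rw [← Real.rpow_natCast, ← Real.rpow_add_of_nonneg he0 (by linarith [hτ.1])
        (by linarith [hτ.2])]
      congr 1
      push_cast
      ring
    have : 0 ≤ e ^ p.τ := by positivity
    calc C * e ^ 3 = e ^ p.τ * (e ^ (3 - p.τ) * C) := by rw [e3]; ring
      _ ≤ e ^ p.τ * 1 := by gcongr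
      _ = _ := mul_one _
  rw [hC] at h4
  rw [hfb] at hsle
  linarith

/-- The unit step along the corrected direction eventually gives sufficient decrease of the
objective. -/
theorem RunNear.eventually_decrease_unit_step {mu : Fin m → ℝ} (hmu : P.IsKKTPair xstar mu)
    (hhess : (fun k => hess (P.lagrangian mu) xstar (d₀ k) - act (B k) (d₀ k)) =o[atTop] d₀) :
    ∀ᶠ k in l, P.f₀ (x k + (d₀ k + d₁ k)) ≤ P.f₀ (x k) + p.α * ⟪P.g₀ (x k), d₀ k⟫_ℝ := by
  obtain ⟨A, hA, hev⟩ := h.exists_second_order_bounds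
  have hτ := h.admissible.τ_mem
  have hα := h.admissible.α_mem
  have hσ : 0 < p.σ := h.admissible.θ_pos.trans h.admissible.θ_lt
  have hL := h.L_pos
  have hM := h.one_le
  have ha := h.a_pos
  set K := L * A + L * A ^ 2 + M * A + m * (M * M * A) + m * M + m * L + 2 with hK
  have hK0 : 0 < K := by positivity
  have hα' : 0 < 1 / 2 - p.α := by linarith [hα.2]
  set ε := min 1 ((1 / 2 - p.α) * a / K) with hε
  have hε0 : 0 < ε := by positivity
  have hε1 : ε ≤ 1 := min_le_left _ _
  have hεK : ε * K ≤ (1 / 2 - p.α) * a := (le_div_iff₀ hK0).1 (min_le_right _ _)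
  have htay := (isLittleO_iff.1 (taylor_two_isLittleO
    (contDiff_lagrangian h.contDiff₀ h.contDiff mu) h.tendsto h.tendsto_d₀)) hε0
  have hlam : ∀ᶠ k in l, ‖lam k - mu‖ ≤ ε := by
    have h1 := (h.tendsto_lam hmu).norm
    rw [norm_zero] at h1
    exact h1.eventually_le_const hε0
  filter_upwards [h.le_atTop h.feasible, h.le_atTop hev,
    h.le_atTop (h.eventually_norm_d₀_le hε0),
    h.le_atTop (h.eventually_rpow_le (sub_pos.2 hτ.1) hε0), htay, hlam,
    h.le_atTop ((isLittleO_iff.1 hhess) hε0)]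
    with k hφ ⟨hd₀, _, hd, h₁, hs, hd₁, hh₁⟩ hke hkτ ht hμ hHB
  have hb := h.bounds k
  have hq := h.run.multiplier k
  have hstep := (h.taylor k).1.add_le hd₀ hd
  change _ ≤ _ + ⟪P.g₀ (x k), d₁ k⟫_ℝ + _ + _ at hstep
  have hquad := hq.sum_mul_abs_fbar
  have hfl : 0 ≤ ∑ j, |P.fbar j (x k)| * |lam k j| := Finset.sum_nonneg fun j _ => by positivity
  have hdesc := hb.descent
  rw [gradient_lagrangian h.contDiff₀ h.contDiff] at ht
  set e := ‖d₀ k‖ with he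
  have he0 : 0 ≤ e := norm_nonneg _
  rw [Real.norm_of_nonneg (sq_nonneg e)] at ht
  -- `T j` is the curvature of a constraint along `d₀`. By stationarity, `⟪g₀, d₁⟫` exceeds `∑ mu j
  -- * T j` by at most a small multiple of `e ^ 2`, which turns the expansion of `f₀` into that of
  -- the Lagrangian.
  set T : Fin m → ℝ := fun j =>
    P.f j (x k + d₀ k) - P.f j (x k) - ⟪P.g j (x k), d₀ k⟫_ℝ with hT
  have hd1e : ‖d₁ k‖ ≤ A * (ε * e) := by
    refine hd₁.trans ?_
    rw [sq]; gcongr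
  have hlamM : ∀ j, |lam k j| ≤ M := fun j => (norm_le_pi_norm (lam k) j).trans hb.lam_le
  have hTle : ∀ j, |T j| ≤ L * e ^ 2 := by
    intro j
    have h1 := (((h.taylor k).2 j) 0 (d₀ k) (by simp; positivity) hd₀).1
    rw [add_zero, sub_zero] at h1
    exact h1
  have hgd : ∀ j, -(lam k j * ⟪P.g j (x k), d₁ k⟫_ℝ) ≤
      M * M * A * ε * e ^ 2 + M * ε * e ^ 2 + (mu j * T j + L * ε * e ^ 2) := by
    intro j
    have hsle := hs.2 j
    unfold rhsCorr at hsle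
    rw [hφ, Real.zero_rpow hσ.ne', add_zero, rpow_eq_sq_mul he0 hτ.1.le] at hsle
    have hhj : |h₁ j| ≤ A * (ε * e) := by
      refine (norm_le_pi_norm h₁ j).trans (hh₁.trans ?_)
      rw [sq]; gcongr
    have hD : -(lam k j * (P.diag (x k) (d₀ k) j * h₁ j)) ≤ M * M * A * ε * e ^ 2 := by
      -- Where the multiplier is nonzero the linearization is tight, so `D j` reduces to `|fbar j| *
      -- e` and the product with `h₁` is of third order.
      have e1 : lam k j * P.diag (x k) (d₀ k) j = lam k j * (|P.fbar j (x k)| * e) := by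
        rcases mul_eq_zero.1 (hq.complementary j) with h0 | h0
        · rw [h0, zero_mul, zero_mul]
        · unfold diag
          rw [h0, abs_zero, zero_add]
      rw [← mul_assoc, e1]
      calc _ ≤ |lam k j * (|P.fbar j (x k)| * e) * h₁ j| := neg_le_abs _
        _ = |lam k j| * (|P.fbar j (x k)| * e) * |h₁ j| := by
          rw [abs_mul, abs_mul, abs_mul, abs_abs, abs_of_nonneg he0]
        _ ≤ M * (M * e) * (A * (ε * e)) := by
          gcongr
          exacts [hlamM j, hb.fbar_le j]
        _ = _ := by ring
    have hR : lam k j * (e ^ 2 * e ^ (p.τ - 2)) ≤ M * ε * e ^ 2 := by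
      calc _ ≤ M * (e ^ 2 * ε) := by
            gcongr
            exact (le_abs_self _).trans (hlamM j)
        _ = _ := by ring
    have hTT : (lam k j - mu j) * T j ≤ L * ε * e ^ 2 := by
      calc _ ≤ |(lam k j - mu j) * T j| := le_abs_self _
        _ = |(lam k - mu) j| * |T j| := abs_mul _ _
        _ ≤ ε * (L * e ^ 2) := by
          gcongr
          exacts [(norm_le_pi_norm (lam k - mu) j).trans hμ, hTle j]
        _ = _ := by ring
    have e2 : ⟪P.g j (x k), d₁ k⟫_ℝ =
        P.diag (x k) (d₀ k) j * h₁ j - e ^ 2 * e ^ (p.τ - 2) - T j := by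
      rw [hT]; linarith
    rw [e2]
    linarith
  have hg₀d : ⟪P.g₀ (x k), d₁ k⟫_ℝ ≤ M * A * ε * e ^ 2 + m * (M * M * A) * ε * e ^ 2 +
      m * M * ε * e ^ 2 + (∑ j, mu j * T j + m * L * ε * e ^ 2) := by
    have e1 : ⟪P.g₀ (x k) + act (B k) (d₀ k) + ∑ j, lam k j • P.g j (x k), d₁ k⟫_ℝ = 0 := by
      rw [hq.stationary, inner_zero_left]
    rw [inner_add_left, inner_add_left, sum_inner] at e1
    have e2 : -⟪act (B k) (d₀ k), d₁ k⟫_ℝ ≤ M * A * ε * e ^ 2 := by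
      calc _ ≤ |⟪act (B k) (d₀ k), d₁ k⟫_ℝ| := neg_le_abs _
        _ ≤ ‖act (B k) (d₀ k)‖ * ‖d₁ k‖ := abs_real_inner_le_norm _ _
        _ ≤ (M * e) * (A * (ε * e)) := by gcongr; exact hb.act_le _
        _ = _ := by ring
    have e3 := Finset.sum_le_sum fun (j : Fin m) (_ : j ∈ Finset.univ) => hgd j
    simp only [Finset.sum_add_distrib, Finset.sum_const, Finset.card_univ, Fintype.card_fin,
      nsmul_eq_mul, Finset.sum_neg_distrib] at e3
    have e4 : ∑ j, ⟪lam k j • P.g j (x k), d₁ k⟫_ℝ = ∑ j, lam k j * ⟪P.g j (x k), d₁ k⟫_ℝ :=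
      Finset.sum_congr rfl fun j _ => by rw [inner_smul_left, conj_trivial]
    rw [e4] at e1
    linarith
  have hTL : P.f₀ (x k + d₀ k) - P.f₀ (x k) - ⟪P.g₀ (x k), d₀ k⟫_ℝ + ∑ j, mu j * T j ≤
      1 / 2 * ⟪d₀ k, hess (P.lagrangian mu) xstar (d₀ k)⟫_ℝ + ε * e ^ 2 := by
    have h1 := (abs_le.1 ht).2
    have e1 : P.lagrangian mu (x k + d₀ k) - P.lagrangian mu (x k) -
        ⟪P.g₀ (x k) + ∑ j, mu j • P.g j (x k), d₀ k⟫_ℝ =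
        P.f₀ (x k + d₀ k) - P.f₀ (x k) - ⟪P.g₀ (x k), d₀ k⟫_ℝ + ∑ j, mu j * T j := by
      simp only [lagrangian, hT, mul_sub, Finset.sum_sub_distrib, inner_add_left, sum_inner,
        inner_smul_left, conj_trivial]
      ring
    linarith
  have hH : ⟪d₀ k, hess (P.lagrangian mu) xstar (d₀ k)⟫_ℝ ≤
      ⟪d₀ k, act (B k) (d₀ k)⟫_ℝ + ε * e ^ 2 := by
    have h1 : ⟪d₀ k, hess (P.lagrangian mu) xstar (d₀ k) - act (B k) (d₀ k)⟫_ℝ ≤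
        e * (ε * e) := (real_inner_le_norm _ _).trans (by gcongr)
    rw [inner_sub_right] at h1
    linarith
  have h2 : L * e * ‖d₁ k‖ ≤ L * A * ε * e ^ 2 := by
    calc L * e * ‖d₁ k‖ ≤ L * e * (A * (ε * e)) := by gcongr
      _ = _ := by ring
  have h3 : L * ‖d₁ k‖ ^ 2 ≤ L * A ^ 2 * ε * e ^ 2 := by
    calc L * ‖d₁ k‖ ^ 2 ≤ L * (A * (ε * e)) ^ 2 := by gcongr
      _ = L * A ^ 2 * ε * e ^ 2 * ε := by ring
      _ ≤ L * A ^ 2 * ε * e ^ 2 * 1 := by gcongr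
      _ = _ := mul_one _
  -- With `H` replaced by `B` and `⟪d₀, B d₀⟫ ≤ -⟪g₀, d₀⟫`, the predicted change is at most `½ ⟪g₀,
  -- d₀⟫`. The errors fit into the margin left by `α < 1/2`.
  have h4 : ε * K * e ^ 2 ≤ (1 / 2 - p.α) * a * e ^ 2 := by gcongr
  have h5 := mul_le_mul_of_nonneg_left hdesc hα'.le
  have h6 : 0 ≤ ε * e ^ 2 := by positivity
  rw [hK] at h4
  linarith

/-- Eventually the algorithm makes the unit step along the corrected direction. -/
theorem RunNear.eventually_unit_step {mu : Fin m → ℝ} (hmu : P.IsKKTPair xstar mu)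
    (hhess : (fun k => hess (P.lagrangian mu) xstar (d₀ k) - act (B k) (d₀ k)) =o[atTop] d₀) :
    ∀ᶠ k in l, x (k + 1) = x k + (d₀ k + d₁ k) := by
  filter_upwards [h.le_atTop h.feasible, h.le_atTop h.eventually_directionTest,
    h.le_atTop h.eventually_feasible_unit_step, h.eventually_decrease_unit_step hmu hhess]
    with k hφ hdir hfeas hdec
  have hacc : P.AcceptI p (x k) (d₀ k) (d₀ k + d₁ k) ((1 / 2) ^ 0) := by
    rw [pow_zero]
    refine ⟨?_, fun j hj => absurd hj (not_lt.2 (phi_eq_zero_iff.1 hφ j)), fun j _ => ?_⟩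
    · rw [hφ, Real.zero_rpow h.admissible.θ_pos.ne', mul_zero, add_zero, mul_one, one_smul]
      exact hdec
    · rw [one_smul]; exact hfeas j
  rcases h.run.update k with ⟨-, i, -, -, hrej, hx⟩ | ⟨hno, -⟩
  · cases i with
    | zero => simpa using hx
    | succ i => exact absurd hacc (hrej 0 (Nat.succ_pos i))
  · exact absurd ⟨hdir, 0, by simpa using h.admissible.ε_mem.2.le, hacc⟩ hno

/-- Superlinear convergence, along a filter to which the iterates converge. -/
theorem RunNear.superlinear {mu : Fin m → ℝ} (hmu : P.IsKKTPair xstar mu)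
    (hsos : P.SSOSC xstar mu)
    (hhess : (fun k => hess (P.lagrangian mu) xstar (d₀ k) - act (B k) (d₀ k)) =o[atTop] d₀) :
    (fun k => x (k + 1) - xstar) =o[l] (fun k => x k - xstar) := by
  have hw := h.full_step_isLittleO hmu hsos hhess
  have hud : ∀ᶠ k in l, ‖x k - xstar‖ ≤ 3 * ‖d₀ k‖ ∧ ‖d₀ k‖ ≤ 3 * ‖x k - xstar‖ := by
    refine eventually_norm_le_of_isLittleO (u := fun k => x k - xstar) (d := d₀) (l := l)
      (hw.congr_left fun k => ?_)
    abel
  have hN : (fun k => ‖x k - xstar‖ + ‖d₀ k‖) =O[l] (fun k => x k - xstar) := by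
    refine IsBigO.of_bound 4 ?_
    filter_upwards [hud] with k hk
    rw [Real.norm_of_nonneg (by positivity)]
    linarith [hk.2]
  have hd₁ : d₁ =o[l] (fun k => x k - xstar) := by
    obtain ⟨A, hA, hev⟩ := h.exists_second_order_bounds
    rw [isLittleO_iff]
    intro c hc
    filter_upwards [hud, h.le_atTop hev,
      h.le_atTop (h.eventually_norm_d₀_le (by positivity : 0 < c / (3 * A)))]
      with k hk ⟨_, _, _, _, _, hd, _⟩ hkc
    rw [le_div_iff₀ (by positivity)] at hkc
    calc ‖d₁ k‖ ≤ A * ‖d₀ k‖ ^ 2 := hd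
      _ = A * ‖d₀ k‖ * ‖d₀ k‖ := by ring
      _ ≤ A * ‖d₀ k‖ * (3 * ‖x k - xstar‖) := by gcongr; exact hk.2
      _ = ‖d₀ k‖ * (3 * A) * ‖x k - xstar‖ := by ring
      _ ≤ c * ‖x k - xstar‖ := by gcongr
  refine ((hw.trans_isBigO hN).add hd₁).congr' ?_ EventuallyEq.rfl
  filter_upwards [h.eventually_unit_step hmu hhess] with k hk
  rw [hk]
  abel

end

end

end Problem

end NCP

theorem theorem5 {n m : ℕ} (P : NCP.Problem n m) (p : NCP.Params) (hp : p.Admissible)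
    (x : ℕ → NCP.E n) (B : ℕ → Matrix (Fin n) (Fin n) ℝ) (d₀ : ℕ → NCP.E n)
    (lam : ℕ → Fin m → ℝ) (d₁ : ℕ → NCP.E n)
    (hrun : P.IsRun p x B d₀ lam d₁)
    (hindep : P.GradientsIndependent)
    (hB : NCP.UniformlyPosDef B)
    (hf₀ : ContDiff ℝ 2 P.f₀) (hf : ∀ j, ContDiff ℝ 2 (P.f j))
    (hbdd : Bornology.IsBounded (Set.range x))
    (xstar : NCP.E n) (hacc : MapClusterPt xstar atTop x)
    (hssosc : ∀ lamstar : Fin m → ℝ, P.IsKKTPair xstar lamstar → P.SSOSC xstar lamstar)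
    (hhess : ∀ lamstar : Fin m → ℝ, P.IsKKTPair xstar lamstar →
      (fun k => NCP.hess (P.lagrangian lamstar) xstar (d₀ k) - NCP.act (B k) (d₀ k))
        =o[atTop] d₀) :
    (∃ lamstar : Fin m → ℝ, P.IsKKTPair xstar lamstar) ∧
      Tendsto x atTop (𝓝 xstar) ∧
      (fun k => x (k + 1) - xstar) =o[atTop] (fun k => x k - xstar) := by
  obtain ⟨a, M, ha, hM, hb⟩ := NCP.Problem.exists_iterBounds hrun hindep hB hf₀ hf hbdd
  obtain ⟨L, hL, hT⟩ := NCP.Problem.exists_taylorBound (P := P) hf₀ hf hbdd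
    (by positivity : (0 : ℝ) ≤ 4 * M ^ 2)
  obtain ⟨hfeas, hd₀⟩ := NCP.Problem.eventually_feasible_and_tendsto hp hrun ha hM hb hL hT
    hf₀.continuous hbdd
  -- This filter is nontrivial exactly because `xstar` is a cluster point. After convergence is
  -- proved along it, the same local analysis is applied with `atTop`.
  have hnear : P.RunNear p x B d₀ lam d₁ a M L (atTop ⊓ comap x (𝓝 xstar)) xstar :=
    ⟨hf₀, hf, hp, hrun, ha, hM, hb, hL, hT, hfeas, hd₀, inf_le_left,
      tendsto_comap.mono_left inf_le_right⟩
  have : (atTop ⊓ comap x (𝓝 xstar)).NeBot := by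
    rw [neBot_inf_comap_iff_map, inf_comm]
    exact hacc
  obtain ⟨mu, hmu⟩ := hnear.exists_isKKTPair
  have hlim := hnear.tendsto_atTop rfl
    (hnear.full_step_isLittleO hmu (hssosc mu hmu) (hhess mu hmu))
  have hnear' : P.RunNear p x B d₀ lam d₁ a M L atTop xstar :=
    { hnear with le_atTop := le_rfl, tendsto := hlim }
  exact ⟨⟨mu, hmu⟩, hlim, hnear'.superlinear hmu (hssosc mu hmu) (hhess mu hmu)⟩
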